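/- Two agents $i\in\{1,2\}$ have states $x_i\in\mathbb R$, $x=[x_1,x_2]^{\mathrm T}$, and payoffs $J_i(x)=\frac12x^{\mathrm T}A_ix+b_i^{\mathrm T}x+c_i$ with symmetric $A_i=(a^i_{jl})\in\mathbb R^{2\times2}$, $a^i_{ii}<0$, $a^1_{11}a^2_{22}\neq a^1_{12}a^2_{12}$, and sensitivities $0<\alpha_i^{\rm L}\le\alpha_i^{\rm H}$. The loss-aversion-based pseudo-gradient dynamics is $\dot x_i(t)=\alpha_i(t)\,\frac{\partial J_i}{\partial x_i}(x(t))$, where $\alpha_i$ is piecewise constant with $\alpha_i(t)=\alpha_i^{\rm L}$ if $\dot J_i(t^-)<0$ and $\alpha_i(t)=\alpha_i^{\rm H}$ if $\dot J_i(t^-)>0$, and agent $i$ switches to its other sensitivity when $\dot J_i=0$ is observed (unless the state rests at the equilibrium). For a mode $k\in\{{\rm LL,HL,LH,HH}\}$ (levels of agents 1 and 2) put $$\mathbb A_k=\mathrm{diag}[\alpha_1^k,\alpha_2^k]\begin{bmatrix}a^1_{11}&a^1_{12}\\a^2_{12}&a^2_{22}\end{bmatrix},\qquad \dot J_i^k(x)=\frac{\partial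 J_i(x)}{\partial x}\,\mathbb A_k(x-x^*),$$ where $x^*$ is the Nash equilibrium, and let $\mathcal D_k$ be the set of all $x$ such that, for each $i$, $\dot J_i^k(x)\le0$ if agent $i$ has level L in $k$ and $\dot J_i^k(x)\ge0$ if it has level H. An active mode $k$ is kept just after time $t$ whenever $x(t)\in\mathrm{int}\,\mathcal D_k$. Let $\hat{\mathcal D}_k$ be the cone with apex $x^*$ obtained from $\mathcal D_k$ by replacing each $\dot J_i^k(x)$ by its linearization at $x^*$, namely $(\mathbb A_k^{\mathrm T}(A_ix^*+b_i))^{\mathrm T}(x-x^*)$. With $\eta(\theta)=[\cos\theta,\sin\theta]^{\mathrm T}$ let $K(\theta)$ be an active mode at phase $\theta$ of the piecewise linearized system $\dot x=\mathbb A_k(x-x^*)$, $x\in\hat{\mathcal D}_k$, i.e. $x^*+r\eta(\theta)\in\hat{\mathcal D}_{K(\theta)}$ for all $r>0$, and let $$\rho_k(\theta)=\frac{\eta(\theta)^{\mathrm T}\mathbb A_k\eta(\theta)}{\det[\eta(\theta),\mathbb A_k\eta(\theta)]},\qquad \gamma_{\rm rg}=\int_{\theta_0}^{\theta_0+2\pi}\rho_{K(\theta)}(\theta)\,d\theta,\qquad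 \theta_0\in\mathbb R.$$ **Theorem 1.** Suppose that every $\mathbb A_k$ has a pair of (non-real) complex conjugate eigenvalues and that $A_ix^*+b_i\neq0$ for $i=1,2$. (1) If $a^1_{12}\gamma_{\rm rg}>0$ and $a^2_{12}\gamma_{\rm rg}<0$, then $x^*$ is a (locally) asymptotically stable equilibrium of the dynamics: it is Lyapunov stable, and for initial states near $x^*$ trajectories on $[0,\infty)$ exist and all of them converge to $x^*$. (2) If $a^1_{12}\gamma_{\rm rg}<0$ and $a^2_{12}\gamma_{\rm rg}>0$, then $x^*$ is unstable (not Lyapunov stable). -/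

import Mathlib

open Set Filter Topology

noncomputable section

namespace LossAversion

/-- Plane vectors `[x₁, x₂]ᵀ`. Index `0` is agent `1`, index `1` is agent `2`.  Only the topology
of the plane matters for (asymptotic) stability, so the choice of the norm is irrelevant. -/
abbrev Plane := Fin 2 → ℝ

/-- The two values (low, high) of a sensitivity parameter. -/
inductive Level
  | L
  | H
  deriving DecidableEq

/-- A mode: the sensitivity level of each agent, e.g. `HL` is `![Level.H, Level.L]`. -/
abbrev Mode := Fin 2 → Level

/-- A two-agent noncooperative system with quadratic payoffs
`J_i(x) = ½ xᵀ A_i x + b_iᵀ x + c_i` together with the sensitivity parameters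
`0 < α_i^L ≤ α_i^H` of the loss-averse agents. -/
structure System where
  A : Fin 2 → Matrix (Fin 2) (Fin 2) ℝ
  b : Fin 2 → Plane
  c : Fin 2 → ℝ
  αL : Fin 2 → ℝ
  αH : Fin 2 → ℝ
  A_symm : ∀ i, (A i).IsSymm
  A_concave : ∀ i, A i i i < 0
  A_nondeg : A 0 0 0 * A 1 1 1 ≠ A 0 0 1 * A 1 0 1
  αL_pos : ∀ i, 0 < αL i
  αL_le_αH : ∀ i, αL i ≤ αH i

namespace System

variable (G : System)

/-- The payoff `J_i`. -/
def payoff (i : Fin 2) (x : Plane) : ℝ :=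
  (1 / 2) * (x ⬝ᵥ (G.A i).mulVec x) + G.b i ⬝ᵥ x + G.c i

/-- The gradient `∂J_i/∂x = A_i x + b_i`. -/
def grad (i : Fin 2) (x : Plane) : Plane := (G.A i).mulVec x + G.b i

/-- `G.grad i x j` is the partial derivative of `J_i` with respect to `x_j`. -/
theorem hasDerivAt_payoff (i j : Fin 2) (x : Plane) :
    HasDerivAt (fun ξ : ℝ => G.payoff i (Function.update x j ξ)) (G.grad i x j) (x j) := by
  have hs : G.A i 1 0 = G.A i 0 1 := (G.A_symm i).apply 0 1
  have key : ∀ p q r y : ℝ,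
      HasDerivAt (fun ξ : ℝ => p / 2 * ξ ^ 2 + q * ξ + r) (p * y + q) y := by
    intro p q r y
    have h := ((((hasDerivAt_id y).pow 2).const_mul (p / 2)).add
      ((hasDerivAt_id y).const_mul q)).add_const r
    refine h.congr_deriv ?_
    simp
    ring
  fin_cases j
  · have e : (fun ξ : ℝ => G.payoff i (Function.update x 0 ξ)) = fun ξ : ℝ =>
        G.A i 0 0 / 2 * ξ ^ 2 + (G.A i 0 1 * x 1 + G.b i 0) * ξ +
          (G.A i 1 1 / 2 * x 1 ^ 2 + G.b i 1 * x 1 + G.c i) := by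
      funext ξ
      simp [payoff, Matrix.mulVec, dotProduct, Fin.sum_univ_two, hs]
      ring
    have e' : G.grad i x 0 = G.A i 0 0 * x 0 + (G.A i 0 1 * x 1 + G.b i 0) := by
      simp [grad]
      ring
    simp only [Fin.zero_eta, e, e']
    exact key _ _ _ _
  · have e : (fun ξ : ℝ => G.payoff i (Function.update x 1 ξ)) = fun ξ : ℝ =>
        G.A i 1 1 / 2 * ξ ^ 2 + (G.A i 0 1 * x 0 + G.b i 1) * ξ +
          (G.A i 0 0 / 2 * x 0 ^ 2 + G.b i 0 * x 0 + G.c i) := by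
      funext ξ
      simp [payoff, Matrix.mulVec, dotProduct, Fin.sum_univ_two, hs]
      ring
    have e' : G.grad i x 1 = G.A i 1 1 * x 1 + (G.A i 0 1 * x 0 + G.b i 1) := by
      simp [grad, hs]
      ring
    simp only [Fin.mk_one, e, e']
    exact key _ _ _ _

/-- `x` is a Nash equilibrium: no agent gains by a unilateral change of its own state. -/
def IsNash (x : Plane) : Prop :=
  ∀ i : Fin 2, ∀ ξ : ℝ, G.payoff i (Function.update x i ξ) ≤ G.payoff i x

/-- The sensitivity of agent `i` at a given level. -/
def α (i : Fin 2) : Level → ℝ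
  | Level.L => G.αL i
  | Level.H => G.αH i

/-- The pseudo-gradient vector field under mode `k`: `ẋ_i = α_i^k ∂J_i/∂x_i`. -/
def field (k : Mode) (x : Plane) : Plane := fun i => G.α i (k i) * G.grad i x i

/-- The system matrix `𝔸_k = diag(α_1^k, α_2^k) [[a¹₁₁, a¹₁₂], [a²₁₂, a²₂₂]]`; one has
`field k x = 𝔸_k (x - x*)`. -/
def sysMatrix (k : Mode) : Matrix (Fin 2) (Fin 2) ℝ :=
  Matrix.diagonal (fun i => G.α i (k i)) *
    !![G.A 0 0 0, G.A 0 0 1; G.A 1 0 1, G.A 1 1 1]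

/-- The rate of change `J̇_i^k(x)` of the payoff of agent `i` at the state `x` under mode `k`. -/
def payoffRate (i : Fin 2) (k : Mode) (x : Plane) : ℝ := G.grad i x ⬝ᵥ G.field k x

/-- `SignOK ℓ v`: the sign of the rate `v` fits the level `ℓ` (losing: low, gaining: high). -/
def SignOK : Level → ℝ → Prop
  | Level.L, v => v ≤ 0
  | Level.H, v => 0 ≤ v

/-- The domain `D_k`. -/
def domain (k : Mode) : Set Plane := {x | ∀ i, SignOK (k i) (G.payoffRate i k x)}

/-- `(x, s)` is a trajectory on `[0, T]` of the pseudo-gradient dynamics with loss-aversion-based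
sensitivities: `x` is the state and `s` the piecewise constant mode signal. -/
structure IsTrajectoryOn (T : ℝ) (x : ℝ → Plane) (s : ℝ → Mode) : Prop where
  continuousOn : ContinuousOn x (Icc 0 T)
  /-- Outside a finite set of instants, the mode is locally constant and
  `ẋ_i = α_i ∂J_i/∂x_i`. -/
  piecewise : ∃ F : Finset ℝ,
    (∀ t ∈ Icc 0 T, t ∉ F → ∀ᶠ u in 𝓝[Icc 0 T] t, s u = s t) ∧
    (∀ t ∈ Ioo 0 T, t ∉ F → HasDerivAt x (G.field (s t) (x t)) t)
  /-- `α_i(t) = α_i^L` if `J̇_i(t⁻) < 0` (the left derivative exists by `piecewise`). -/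
  low : ∀ i, ∀ t ∈ Ioc 0 T,
    derivWithin (fun u => G.payoff i (x u)) (Iic t) t < 0 → s t i = Level.L
  /-- `α_i(t) = α_i^H` if `J̇_i(t⁻) > 0`. -/
  high : ∀ i, ∀ t ∈ Ioc 0 T,
    0 < derivWithin (fun u => G.payoff i (x u)) (Iic t) t → s t i = Level.H
  /-- Agent `i` switches to its other sensitivity when it observes `J̇_i = 0`, unless the state
  rests at an equilibrium. -/
  switch : ∀ i, ∀ t ∈ Ioc 0 T,
    derivWithin (fun u => G.payoff i (x u)) (Iic t) t = 0 → ¬ G.IsNash (x t) →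
      ∀ᶠ u in 𝓝[<] t, s u i ≠ s t i
  /-- Given the active mode `k` at time `t`, the mode `k` is kept at time `t⁺` if the state lies
  in the interior of `D_k`. -/
  keep : ∀ t ∈ Ico 0 T, x t ∈ interior (G.domain (s t)) → ∀ᶠ u in 𝓝[>] t, s u = s t

/-- A trajectory on `[0, ∞)`. -/
def IsTrajectory (x : ℝ → Plane) (s : ℝ → Mode) : Prop :=
  ∀ T : ℝ, 0 < T → G.IsTrajectoryOn T x s

/-- Lyapunov stability of `p`. -/
def IsStable (p : Plane) : Prop :=
  ∀ ε > 0, ∃ δ > 0, ∀ (T : ℝ) (x : ℝ → Plane) (s : ℝ → Mode), G.IsTrajectoryOn T x s →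
    dist (x 0) p < δ → ∀ t ∈ Icc 0 T, dist (x t) p < ε

/-- (Local) asymptotic stability of `p`: `p` is stable, and for initial states near `p`
trajectories on `[0, ∞)` exist and all of them converge to `p`. -/
def IsAsymptoticallyStable (p : Plane) : Prop :=
  G.IsStable p ∧ ∃ δ > 0,
    (∀ x₀ : Plane, dist x₀ p < δ → ∃ x s, G.IsTrajectory x s ∧ x 0 = x₀) ∧
    (∀ x s, G.IsTrajectory x s → dist (x 0) p < δ → Tendsto x atTop (𝓝 p))

/-- Instability: the failure of Lyapunov stability. -/
def IsUnstable (p : Plane) : Prop := ¬ G.IsStable p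

/-- Every `𝔸_k` has a pair of (non-real) complex conjugate eigenvalues. -/
def HasComplexEigenvalues : Prop :=
  ∀ k : Mode, ∃ z : ℂ, z.im ≠ 0 ∧
    Module.End.HasEigenvalue (Matrix.toLin' ((G.sysMatrix k).map Complex.ofReal)) z ∧
    Module.End.HasEigenvalue (Matrix.toLin' ((G.sysMatrix k).map Complex.ofReal))
      (starRingEnd ℂ z)

/-- `β_i^k = 𝔸_kᵀ (A_i p + b_i)`, the gradient of `J̇_i^k` at the Nash equilibrium `p`. -/
def rateGrad (p : Plane) (i : Fin 2) (k : Mode) : Plane :=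
  (G.sysMatrix k).transpose.mulVec (G.grad i p)

/-- The approximated domain `D̂_k` at `p`: the inequalities that define `D_k`, linearized at the
Nash equilibrium `p`. -/
def approxDomain (p : Plane) (k : Mode) : Set Plane :=
  {x | ∀ i, SignOK (k i) (G.rateGrad p i k ⬝ᵥ (x - p))}

/-- The unit vector of phase `θ`. -/
def unitVec (θ : ℝ) : Plane := ![Real.cos θ, Real.sin θ]

/-- `K θ` is an active mode, at phase `θ` around `p`, of the piecewise linearized system
`ẋ = 𝔸_k (x - p)`, `x ∈ D̂_k`. -/
def IsActiveMode (p : Plane) (K : ℝ → Mode) : Prop :=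
  ∀ θ r : ℝ, 0 < r → p + r • unitVec θ ∈ G.approxDomain p (K θ)

/-- The normalized radial growth rate
`ρ_k(θ) = (1/r) dr/dθ = η(θ)ᵀ 𝔸_k η(θ) / det [η(θ), 𝔸_k η(θ)]`. -/
def radialRate (k : Mode) (θ : ℝ) : ℝ :=
  let η := unitVec θ
  let v := (G.sysMatrix k).mulVec η
  (η ⬝ᵥ v) / Matrix.det !![η 0, v 0; η 1, v 1]

/-- The integral `γ_rg` of the normalized radial growth rate over one round. -/
def radialGrowth (K : ℝ → Mode) (θ₀ : ℝ) : ℝ :=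
  ∫ θ in θ₀..(θ₀ + 2 * Real.pi), G.radialRate (K θ) θ

end System

end LossAversion

end

noncomputable section

namespace LossAversion

open Asymptotics

/-! At the Nash equilibrium the gradient of `J_i` has only its cross component, with respect to the
other agent's state. The linearized rate of `J_i` is therefore a positive multiple of `G.grad i p j`
times the marginal of the other agent `j`. The switching line of agent `i` is thus the zero line of
that marginal, the same for every mode. Complex eigenvalues make every mode rotate around `p` with
the sign of `G.A 1 0 1`, so the phase can serve as time, and `radialGrowth` is the change of `log r`
per turn of the piecewise linearized system.

The true domains differ from their linearizations to higher order, so near a switching line several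
modes may be active. `exists_envelope` replaces the radial rate of the selected mode by a continuous
periodic function that still has the right mean and dominates all modes that nearly satisfy the
linearized sign conditions. Integrating its mean-free part over the phase gives a correction `Ψ` for
which `|y|² exp (-2 Ψ (arg y))` decays, respectively grows, exponentially along every trajectory
near `p` (`exists_lyapunov`). Decay yields stability and attraction.

Existence of global trajectories remains. In a narrow cone around a switching line the relevant
payoff rate is monotone along the flow, with a direction that does not depend on the mode; outside
the cone its sign does not depend on the mode (`exists_transversal`). So after a zero of the rate
the flipped mode can be followed, and it then lasts a time independent of the distance to `p`
(`exists_step`). This excludes accumulation of switches, and stability confines the construction to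
the neighbourhood where it works. For instability, assumed stability would give a global trajectory
that stays near `p`, against exponential growth. -/

/-- The sign attached to a level. -/
def Level.sgn : Level → ℝ
  | Level.L => -1
  | Level.H => 1

theorem Level.sgn_eq (ℓ : Level) : ℓ.sgn = 1 ∨ ℓ.sgn = -1 := by
  cases ℓ <;> simp [Level.sgn]

/-- The opposite level. -/
def Level.flip : Level → Level
  | Level.L => Level.H
  | Level.H => Level.L

theorem Level.sgn_flip (ℓ : Level) : ℓ.flip.sgn = -ℓ.sgn := by
  cases ℓ <;> simp [Level.flip, Level.sgn]

theorem Level.flip_ne (ℓ : Level) : ℓ ≠ ℓ.flip := by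
  cases ℓ <;> simp [Level.flip]

theorem Level.eq_flip_of_ne {ℓ m : Level} (h : ℓ ≠ m) : ℓ = m.flip := by
  cases ℓ <;> cases m <;> simp_all [Level.flip]

instance : Inhabited Level := ⟨Level.L⟩

instance : Fintype Level := ⟨{Level.L, Level.H}, fun ℓ => by cases ℓ <;> simp⟩

/-! ### Payoff rates and their first-order expansions at a Nash equilibrium -/

namespace System

theorem signOK_iff (ℓ : Level) (v : ℝ) : SignOK ℓ v ↔ 0 ≤ ℓ.sgn * v := by
  cases ℓ <;> simp [SignOK, Level.sgn]

variable (G : System)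

theorem α_pos (i : Fin 2) (ℓ : Level) : 0 < G.α i ℓ := by
  cases ℓ
  · exact G.αL_pos i
  · exact (G.αL_pos i).trans_le (G.αL_le_αH i)

theorem A_comm (i j l : Fin 2) : G.A i j l = G.A i l j := (G.A_symm i).apply l j

/-- The marginal payoff of agent `i` at a displacement `y` from a Nash equilibrium. -/
def marginal (i : Fin 2) (y : Plane) : ℝ := G.A i i 0 * y 0 + G.A i i 1 * y 1

theorem marginal_smul (i : Fin 2) (r : ℝ) (y : Plane) :
    G.marginal i (r • y) = r * G.marginal i y := by
  simp [marginal]; ring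

theorem continuous_marginal (i : Fin 2) : Continuous (G.marginal i) := by
  unfold marginal; fun_prop

/-- The derivative of `payoffRate i k` along the vector field of mode `k`. -/
def rateDeriv (i : Fin 2) (k : Mode) (x : Plane) : ℝ :=
  (G.A i).mulVec (G.field k x) ⬝ᵥ G.field k x +
    G.grad i x ⬝ᵥ fun j => G.α j (k j) * (G.A j).mulVec (G.field k x) j

theorem grad_apply (i j : Fin 2) (x : Plane) :
    G.grad i x j = G.A i j 0 * x 0 + G.A i j 1 * x 1 + G.b i j := by
  simp only [grad, Matrix.mulVec, dotProduct, Fin.sum_univ_two, Pi.add_apply]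

theorem hasDerivAt_grad {x : ℝ → Plane} {v : Plane} {t : ℝ} (h : HasDerivAt x v t)
    (i j : Fin 2) : HasDerivAt (fun u => G.grad i (x u) j) ((G.A i).mulVec v j) t := by
  have h0 := hasDerivAt_pi.1 h 0
  have h1 := hasDerivAt_pi.1 h 1
  have := ((h0.const_mul (G.A i j 0)).add (h1.const_mul (G.A i j 1))).add_const (G.b i j)
  refine (this.congr_of_eventuallyEq ?_).congr_deriv ?_
  · refine Eventually.of_forall fun u => ?_
    simp [grad_apply]
  · simp only [Matrix.mulVec, dotProduct, Fin.sum_univ_two]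

theorem hasDerivAt_payoff_comp {x : ℝ → Plane} {k : Mode} {t : ℝ}
    (h : HasDerivAt x (G.field k (x t)) t) (i : Fin 2) :
    HasDerivAt (fun u => G.payoff i (x u)) (G.payoffRate i k (x t)) t := by
  have h0 := hasDerivAt_pi.1 h 0
  have h1 := hasDerivAt_pi.1 h 1
  have hs := G.A_comm i 1 0
  have e : (fun u => G.payoff i (x u)) = fun u =>
      G.A i 0 0 / 2 * (x u 0 * x u 0) + G.A i 0 1 * (x u 0 * x u 1) +
      G.A i 1 1 / 2 * (x u 1 * x u 1) + G.b i 0 * x u 0 + G.b i 1 * x u 1 + G.c i := by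
    funext u
    simp [payoff, Matrix.mulVec, dotProduct, Fin.sum_univ_two, hs]
    ring
  rw [e]
  refine ((((((h0.mul h0).const_mul _).add ((h0.mul h1).const_mul _)).add
    ((h1.mul h1).const_mul _)).add (h0.const_mul _)).add (h1.const_mul _)
    |>.add_const _).congr_deriv ?_
  simp [payoffRate, grad, dotProduct, Fin.sum_univ_two, hs]
  ring

theorem hasDerivAt_payoffRate_comp {x : ℝ → Plane} {k : Mode} {t : ℝ}
    (h : HasDerivAt x (G.field k (x t)) t) (i : Fin 2) :
    HasDerivAt (fun u => G.payoffRate i k (x u)) (G.rateDeriv i k (x t)) t := by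
  have hg := fun a b => G.hasDerivAt_grad h a b
  have e : (fun u => G.payoffRate i k (x u)) = fun u =>
      G.grad i (x u) 0 * (G.α 0 (k 0) * G.grad 0 (x u) 0) +
      G.grad i (x u) 1 * (G.α 1 (k 1) * G.grad 1 (x u) 1) := by
    funext u
    simp [payoffRate, field, dotProduct, Fin.sum_univ_two]
  rw [e]
  refine (((hg i 0).mul ((hg 0 0).const_mul _)).add
    ((hg i 1).mul ((hg 1 1).const_mul _))).congr_deriv ?_
  simp [rateDeriv, dotProduct, Fin.sum_univ_two, field]
  ring

section Nash

variable {G} {p : Plane} (hp : G.IsNash p)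
include hp

theorem IsNash.grad_eq_zero (i : Fin 2) : G.grad i p i = 0 := by
  have h := G.hasDerivAt_payoff i i p
  refine IsLocalMax.hasDerivAt_eq_zero ?_ h
  refine Eventually.of_forall fun ξ => ?_
  simpa using hp i ξ

theorem IsNash.grad_eq_marginal (i : Fin 2) (x : Plane) :
    G.grad i x i = G.marginal i (x - p) := by
  have h := hp.grad_eq_zero i
  simp only [grad, marginal, Matrix.mulVec, dotProduct, Fin.sum_univ_two, Pi.add_apply,
    Pi.sub_apply] at h ⊢
  linear_combination h

theorem IsNash.field_apply (k : Mode) (x : Plane) (i : Fin 2) :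
    G.field k x i = G.α i (k i) * G.marginal i (x - p) := by
  rw [field, hp.grad_eq_marginal]

theorem IsNash.field_self (k : Mode) : G.field k p = 0 := by
  funext i; simp [hp.field_apply, marginal]

/-- Splits the rate into the agent's own contribution, quadratic in the displacement and
proportional to its own sensitivity, and the contribution of the other agent, which dominates near
`p`. -/
theorem IsNash.payoffRate_eq (k : Mode) (x : Plane) {i j : Fin 2} (hij : i ≠ j) :
    G.payoffRate i k x = G.α i (k i) * G.marginal i (x - p) ^ 2 +
      G.grad i x j * (G.α j (k j) * G.marginal j (x - p)) := by
  have : G.payoffRate i k x = G.grad i x i * (G.α i (k i) * G.marginal i (x - p)) +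
      G.grad i x j * (G.α j (k j) * G.marginal j (x - p)) := by
    rw [payoffRate, dotProduct, Fin.sum_univ_two]
    simp only [hp.field_apply]
    fin_cases i <;> fin_cases j <;> simp_all
    ring
  rw [this, hp.grad_eq_marginal]; ring

end Nash

theorem grad_sub (p : Plane) (i j : Fin 2) (x : Plane) :
    G.grad i x j = G.grad i p j + (G.A i j 0 * (x - p) 0 + G.A i j 1 * (x - p) 1) := by
  simp only [grad_apply, Pi.sub_apply]; ring

theorem isBigO_linear (p : Plane) (a b : ℝ) :
    (fun x : Plane => a * (x - p) 0 + b * (x - p) 1) =O[𝓝 p] fun x => ‖x - p‖ := by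
  have h : ∀ l : Fin 2, (fun x : Plane => (x - p) l) =O[𝓝 p] fun x => ‖x - p‖ := fun l =>
    IsBigO.of_norm_le fun x => norm_le_pi_norm (x - p) l
  exact ((h 0).const_mul_left a).add ((h 1).const_mul_left b)

theorem isLittleO_one_of_isBigO {p : Plane} {f : Plane → ℝ} (h : f =O[𝓝 p] fun x => ‖x - p‖) :
    f =o[𝓝 p] fun _ => (1 : ℝ) := by
  refine h.trans_isLittleO ((isLittleO_one_iff ℝ).2 ?_)
  have : Continuous fun x : Plane => ‖x - p‖ := by fun_prop
  simpa using this.tendsto p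

theorem isLittleO_mul {p : Plane} {f g : Plane → ℝ} (hf : f =O[𝓝 p] fun x => ‖x - p‖)
    (hg : g =O[𝓝 p] fun x => ‖x - p‖) : (fun x => f x * g x) =o[𝓝 p] fun x => ‖x - p‖ := by
  simpa using (isLittleO_one_of_isBigO hf).mul_isBigO hg

theorem isBigO_marginal (p : Plane) (i : Fin 2) :
    (fun x : Plane => G.marginal i (x - p)) =O[𝓝 p] fun x => ‖x - p‖ :=
  isBigO_linear p _ _

/-- Everything except the cross gradient at `p` times the other agent's velocity is a product of two
factors that are `O(‖x - p‖)`. -/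
theorem payoffRate_isLittleO {p : Plane} (hp : G.IsNash p) (k : Mode) {i j : Fin 2}
    (hij : i ≠ j) :
    (fun x => G.payoffRate i k x - G.grad i p j * (G.α j (k j) * G.marginal j (x - p)))
      =o[𝓝 p] fun x => ‖x - p‖ := by
  have hm := G.isBigO_marginal p
  have e : (fun x => G.payoffRate i k x - G.grad i p j * (G.α j (k j) * G.marginal j (x - p))) =
      fun x => G.α i (k i) * G.marginal i (x - p) * G.marginal i (x - p) +
        (G.A i j 0 * (x - p) 0 + G.A i j 1 * (x - p) 1) *
          (G.α j (k j) * G.marginal j (x - p)) := by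
    funext x
    rw [hp.payoffRate_eq k x hij, G.grad_sub p i j x]; ring
  rw [e]
  exact (isLittleO_mul ((hm i).const_mul_left _) (hm i)).add
    (isLittleO_mul (isBigO_linear p _ _) ((hm j).const_mul_left _))

theorem rateDeriv_isLittleO {p : Plane} (hp : G.IsNash p) (k : Mode) {i j : Fin 2}
    (hij : i ≠ j) :
    (fun x => G.rateDeriv i k x - G.grad i p j * (G.α j (k j) *
      (G.A j j i * (G.α i (k i) * G.marginal i (x - p)) +
        G.A j j j * (G.α j (k j) * G.marginal j (x - p)))))
      =o[𝓝 p] fun x => ‖x - p‖ := by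
  have hF : ∀ l, (fun x => G.field k x l) =O[𝓝 p] fun x => ‖x - p‖ := fun l => by
    simpa only [hp.field_apply] using (G.isBigO_marginal p l).const_mul_left _
  have hA : ∀ l m, (fun x => (G.A l).mulVec (G.field k x) m) =O[𝓝 p] fun x => ‖x - p‖ := by
    intro l m
    simpa [Matrix.mulVec, dotProduct, Fin.sum_univ_two] using
      ((hF 0).const_mul_left (G.A l m 0)).add ((hF 1).const_mul_left (G.A l m 1))
  have e : (fun x => G.rateDeriv i k x - G.grad i p j * (G.α j (k j) *
      (G.A j j i * (G.α i (k i) * G.marginal i (x - p)) +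
        G.A j j j * (G.α j (k j) * G.marginal j (x - p))))) =
      fun x => ((G.A i).mulVec (G.field k x) 0 * G.field k x 0 +
        (G.A i).mulVec (G.field k x) 1 * G.field k x 1) +
        (G.marginal i (x - p) * (G.α i (k i) * (G.A i).mulVec (G.field k x) i) +
        (G.A i j 0 * (x - p) 0 + G.A i j 1 * (x - p) 1) *
          (G.α j (k j) * (G.A j).mulVec (G.field k x) j)) := by
    funext x
    have h1 : G.rateDeriv i k x = ((G.A i).mulVec (G.field k x) 0 * G.field k x 0 +
        (G.A i).mulVec (G.field k x) 1 * G.field k x 1) +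
        (G.grad i x i * (G.α i (k i) * (G.A i).mulVec (G.field k x) i) +
        G.grad i x j * (G.α j (k j) * (G.A j).mulVec (G.field k x) j)) := by
      simp only [rateDeriv, dotProduct, Fin.sum_univ_two]
      fin_cases i <;> fin_cases j <;> simp_all
      ring
    have h2 : (G.A j).mulVec (G.field k x) j = G.A j j i * (G.α i (k i) * G.marginal i (x - p)) +
        G.A j j j * (G.α j (k j) * G.marginal j (x - p)) := by
      simp only [Matrix.mulVec, dotProduct, Fin.sum_univ_two, hp.field_apply]
      fin_cases i <;> fin_cases j <;> simp_all
      ring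
    rw [h1, G.grad_sub p i j x, hp.grad_eq_marginal, ← h2]; ring
  rw [e]
  exact ((isLittleO_mul (hA i 0) (hF 0)).add (isLittleO_mul (hA i 1) (hF 1))).add
    ((isLittleO_mul (G.isBigO_marginal p i) ((hA i i).const_mul_left _)).add
      (isLittleO_mul (isBigO_linear p _ _) ((hA j j).const_mul_left _)))

/-! ### Complex eigenvalues, coupling and transversality to the switching lines -/

theorem sysMatrix_mulVec (k : Mode) (y : Plane) (i : Fin 2) :
    (G.sysMatrix k).mulVec y i = G.α i (k i) * G.marginal i y := by
  have := G.A_comm 1 0 1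
  fin_cases i <;> simp [sysMatrix, marginal, Matrix.mulVec, dotProduct, Fin.sum_univ_two,
    Matrix.mul_apply, Matrix.diagonal, this] <;> ring

theorem discrim_neg (hG : G.HasComplexEigenvalues) (k : Mode) :
    (G.α 0 (k 0) * G.A 0 0 0 - G.α 1 (k 1) * G.A 1 1 1) ^ 2 +
      4 * (G.α 0 (k 0) * G.α 1 (k 1)) * (G.A 0 0 1 * G.A 1 0 1) < 0 := by
  obtain ⟨z, hz, hv, -⟩ := hG k
  obtain ⟨v, hv⟩ := hv.exists_hasEigenvector
  have h1 := hv.apply_eq_smul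
  have h2 := hv.2
  have e0 := congrFun h1 0
  have e1 := congrFun h1 1
  simp [sysMatrix, Matrix.mulVec, dotProduct, Fin.sum_univ_two, Matrix.mul_apply,
    Matrix.diagonal] at e0 e1
  set a := G.α 0 (k 0)
  set d := G.α 1 (k 1)
  -- The characteristic equation at `z`, by Cramer's rule on a nonzero eigenvector. Its imaginary
  -- part gives the trace as `2 * z.re`, and then its real part gives the discriminant as `-4 * z.im
  -- ^ 2`.
  have hdet : ((a * G.A 0 0 0 : ℝ) - z) * ((d * G.A 1 1 1 : ℝ) - z) -
      (a * G.A 0 0 1 : ℝ) * (d * G.A 1 0 1 : ℝ) = 0 := by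
    by_contra hne
    apply h2
    push_cast at hne
    have v0 : v 0 = 0 := by
      apply mul_left_cancel₀ hne
      linear_combination ((d * G.A 1 1 1 : ℂ) - z) * e0 - (a * G.A 0 0 1 : ℂ) * e1
    have v1 : v 1 = 0 := by
      apply mul_left_cancel₀ hne
      linear_combination ((a * G.A 0 0 0 : ℂ) - z) * e1 - (d * G.A 1 0 1 : ℂ) * e0
    funext i; fin_cases i <;> simp [v0, v1]
  have hre := congrArg Complex.re hdet
  have him := congrArg Complex.im hdet
  simp at hre him
  have htr : 2 * z.re = a * G.A 0 0 0 + d * G.A 1 1 1 := by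
    apply mul_right_cancel₀ hz
    linear_combination him
  have : (a * G.A 0 0 0 - d * G.A 1 1 1) ^ 2 + 4 * (a * d) * (G.A 0 0 1 * G.A 1 0 1) =
      -4 * z.im ^ 2 := by
    linear_combination -4 * hre + (2 * z.re - a * G.A 0 0 0 - d * G.A 1 1 1) * htr
  rw [this]
  have := sq_pos_of_ne_zero hz
  linarith

theorem coupling_neg (hG : G.HasComplexEigenvalues) : G.A 0 0 1 * G.A 1 0 1 < 0 := by
  have h := G.discrim_neg hG (fun _ => Level.L)
  have h1 := mul_pos (G.α_pos 0 Level.L) (G.α_pos 1 Level.L)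
  have h2 := sq_nonneg (G.α 0 Level.L * G.A 0 0 0 - G.α 1 Level.L * G.A 1 1 1)
  by_contra hc
  push Not at hc
  have := mul_nonneg h1.le hc
  linarith

theorem coupling_ne (hG : G.HasComplexEigenvalues) {i j : Fin 2} (hij : i ≠ j) :
    G.A j j i ≠ 0 := by
  have h := G.coupling_neg hG
  have hs := G.A_comm 1 0 1
  intro h0
  fin_cases i <;> fin_cases j <;> simp_all

/-- By `A_nondeg` the two marginals are linear coordinates, inverted by Cramer's rule. Hence they
cannot both be small, and the narrow cones around the two switching lines are disjoint. -/
theorem exists_norm_le_marginal : ∃ c > 0, ∀ y : Plane, ∀ i j : Fin 2, i ≠ j →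
    c * ‖y‖ ≤ max |G.marginal i y| |G.marginal j y| := by
  have hs := G.A_comm 1 0 1
  set D := G.A 0 0 0 * G.A 1 1 1 - G.A 0 0 1 * G.A 1 0 1 with hD
  have hD0 : 0 < |D| := abs_pos.2 (sub_ne_zero.2 G.A_nondeg)
  set B := |G.A 0 0 0| + |G.A 0 0 1| + |G.A 1 0 1| + |G.A 1 1 1|
  have hB : 0 < B := by
    have := abs_pos.2 (G.A_concave 0).ne
    positivity
  have key : ∀ y : Plane, |D| * ‖y‖ ≤ B * max |G.marginal 0 y| |G.marginal 1 y| := by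
    intro y
    set M := max |G.marginal 0 y| |G.marginal 1 y|
    have m0 : |G.marginal 0 y| ≤ M := le_max_left _ _
    have m1 : |G.marginal 1 y| ≤ M := le_max_right _ _
    have hM : 0 ≤ M := (abs_nonneg _).trans m0
    have hcomb : ∀ a b : ℝ, |a| + |b| ≤ B →
        |a * G.marginal 0 y + b * G.marginal 1 y| ≤ B * M := by
      intro a b hab
      calc _ ≤ |a| * |G.marginal 0 y| + |b| * |G.marginal 1 y| := by
            rw [← abs_mul, ← abs_mul]; exact abs_add_le _ _
        _ ≤ |a| * M + |b| * M := by gcongr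
        _ = (|a| + |b|) * M := by ring
        _ ≤ B * M := by gcongr
    have n1 := abs_nonneg (G.A 0 0 0)
    have n2 := abs_nonneg (G.A 0 0 1)
    have n3 := abs_nonneg (G.A 1 0 1)
    have n4 := abs_nonneg (G.A 1 1 1)
    have y0 : |D| * |y 0| ≤ B * M := by
      have e : D * y 0 = (G.A 1 1 1) * G.marginal 0 y + (-G.A 0 0 1) * G.marginal 1 y := by
        simp only [marginal, hs, hD]; ring
      rw [← abs_mul, e]
      exact hcomb (G.A 1 1 1) (-G.A 0 0 1) (by rw [abs_neg]; linarith)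
    have y1 : |D| * |y 1| ≤ B * M := by
      have e : D * y 1 = (-G.A 1 0 1) * G.marginal 0 y + (G.A 0 0 0) * G.marginal 1 y := by
        simp only [marginal, hs, hD]; ring
      rw [← abs_mul, e]
      exact hcomb (-G.A 1 0 1) (G.A 0 0 0) (by rw [abs_neg]; linarith)
    rw [← le_div_iff₀' hD0]
    refine (pi_norm_le_iff_of_nonneg (by positivity)).2 fun l => ?_
    rw [le_div_iff₀' hD0]
    fin_cases l
    · exact y0
    · exact y1
  refine ⟨|D| / B, by positivity, fun y i j hij => ?_⟩
  have hk : |D| / B * ‖y‖ ≤ max |G.marginal 0 y| |G.marginal 1 y| := by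
    rw [div_mul_eq_mul_div, div_le_iff₀' hB]; exact key y
  fin_cases i <;> fin_cases j <;> simp_all [max_comm]

/-- Sign structure of the payoff rates and of their derivatives near a Nash equilibrium. -/
theorem exists_transversal {p : Plane} (hp : G.IsNash p) (hG : G.HasComplexEigenvalues)
    (hg : ∀ i j, i ≠ j → G.grad i p j ≠ 0) :
    ∃ κ > 0, ∀ᶠ x in 𝓝 p, x ≠ p → ∀ k : Mode, ∀ i j : Fin 2, i ≠ j →
      (κ * ‖x - p‖ < |G.marginal j (x - p)| →
        0 < G.grad i p j * G.marginal j (x - p) * G.payoffRate i k x) ∧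
      (|G.marginal j (x - p)| ≤ 2 * κ * ‖x - p‖ →
        2 * κ * ‖x - p‖ < |G.marginal i (x - p)| ∧
        0 < G.grad i p j * G.A j j i * G.marginal i (x - p) * G.rateDeriv i k x) := by
  obtain ⟨c, hc, hcm⟩ := G.exists_norm_le_marginal
  -- The first condition forces the marginal of `i` to be at least `c * ‖x - p‖` in the cone where
  -- that of `j` is small. The second makes the own-concavity term of the derivative less than half
  -- of the coupling term; the other half is left for the remainder.
  have hκ : ∀ᶠ κ in 𝓝[>] (0 : ℝ), 2 * κ < c ∧ ∀ k : Mode, ∀ i j : Fin 2, i ≠ j →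
      G.α j (k j) * |G.A j j j| * (2 * κ) < |G.A j j i| * G.α i (k i) * c / 2 := by
    apply Filter.Eventually.filter_mono nhdsWithin_le_nhds
    refine Eventually.and ?_ ?_
    · have : Continuous fun κ : ℝ => 2 * κ := by fun_prop
      exact this.continuousAt.eventually_lt continuousAt_const (by simpa using hc)
    · refine eventually_all.2 fun k => eventually_all.2 fun i => eventually_all.2 fun j => ?_
      by_cases hij : i = j
      · simp [hij]
      have : Continuous fun κ : ℝ => G.α j (k j) * |G.A j j j| * (2 * κ) := by fun_prop
      refine (this.continuousAt.eventually_lt continuousAt_const ?_).mono fun κ h _ => h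
      have h1 := abs_pos.2 (G.coupling_ne hG hij)
      have h2 := G.α_pos i (k i)
      simp only [mul_zero]
      positivity
  obtain ⟨κ, ⟨hκc, hκA⟩, hκ0 : 0 < κ⟩ := (hκ.and self_mem_nhdsWithin).exists
  refine ⟨κ, hκ0, ?_⟩
  suffices h : ∀ᶠ x in 𝓝 p, ∀ k : Mode, ∀ i j : Fin 2, x ≠ p → i ≠ j →
      (κ * ‖x - p‖ < |G.marginal j (x - p)| →
        0 < G.grad i p j * G.marginal j (x - p) * G.payoffRate i k x) ∧
      (|G.marginal j (x - p)| ≤ 2 * κ * ‖x - p‖ →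
        2 * κ * ‖x - p‖ < |G.marginal i (x - p)| ∧
        0 < G.grad i p j * G.A j j i * G.marginal i (x - p) * G.rateDeriv i k x) from
    h.mono fun x hx hxp k i j => hx k i j hxp
  refine eventually_all.2 fun k => eventually_all.2 fun i => eventually_all.2 fun j => ?_
  by_cases hij : i = j
  · simp [hij]
  have hαi := G.α_pos i (k i)
  have hαj := G.α_pos j (k j)
  have hgp := abs_pos.2 (hg i j hij)
  have hqp := abs_pos.2 (G.coupling_ne hG hij)
  have hε1 : 0 < |G.grad i p j| * G.α j (k j) * κ := by positivity
  have hε2 : 0 < |G.grad i p j| * G.α j (k j) * (|G.A j j i| * G.α i (k i) * c / 2) := by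
    positivity
  filter_upwards [(G.payoffRate_isLittleO hp k hij).bound hε1,
    (G.rateDeriv_isLittleO hp k hij).bound hε2] with x hR hS hxp _
  have hy : 0 < ‖x - p‖ := norm_pos_iff.2 (sub_ne_zero.2 hxp)
  -- Reduces both claims to an error estimate: a quantity has the sign of its leading term once the
  -- error is smaller than that term.
  have sign_of_close : ∀ u v : ℝ, |v - u| < |u| → 0 < u * v := by
    intro u v h
    rcases le_or_gt 0 u with h0 | h0
    · rw [abs_of_nonneg h0] at h
      have := abs_lt.1 h
      have hu : 0 < u := lt_of_le_of_ne h0 (by rintro rfl; linarith [abs_nonneg (v - 0)])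
      exact mul_pos hu (by linarith)
    · rw [abs_of_neg h0] at h
      have := abs_lt.1 h
      exact mul_pos_of_neg_of_neg h0 (by linarith)
  simp only [Real.norm_eq_abs, abs_norm] at hR hS
  refine ⟨fun hj => ?_, fun hj => ?_⟩
  · have h1 : 0 < (G.grad i p j * (G.α j (k j) * G.marginal j (x - p))) *
        G.payoffRate i k x := by
      apply sign_of_close
      refine hR.trans_lt ?_
      rw [abs_mul, abs_mul, abs_of_pos hαj]
      calc _ = |G.grad i p j| * (G.α j (k j) * (κ * ‖x - p‖)) := by ring
        _ < _ := by gcongr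
    refine pos_of_mul_pos_right (a := G.α j (k j)) ?_ hαj.le
    linarith
  · have hi : c * ‖x - p‖ ≤ |G.marginal i (x - p)| := by
      rcases le_max_iff.1 (hcm (x - p) i j hij) with h | h
      · exact h
      · exfalso
        have := mul_lt_mul_of_pos_right hκc hy
        linarith
    refine ⟨(mul_lt_mul_of_pos_right hκc hy).trans_le hi, ?_⟩
    set z := G.marginal i (x - p)
    set w := G.marginal j (x - p)
    have h1 : 0 < (G.grad i p j * (G.α j (k j) * (G.A j j i * (G.α i (k i) * z)))) *
        G.rateDeriv i k x := by
      apply sign_of_close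
      have e : G.rateDeriv i k x - G.grad i p j * (G.α j (k j) * (G.A j j i * (G.α i (k i) * z)))
          = (G.rateDeriv i k x - G.grad i p j * (G.α j (k j) *
            (G.A j j i * (G.α i (k i) * z) + G.A j j j * (G.α j (k j) * w)))) +
            G.grad i p j * (G.α j (k j) * (G.A j j j * (G.α j (k j) * w))) := by ring
      rw [e]
      have h2 : |G.grad i p j * (G.α j (k j) * (G.A j j j * (G.α j (k j) * w)))| <
          |G.grad i p j| * G.α j (k j) * (|G.A j j i| * G.α i (k i) * c / 2) * ‖x - p‖ := by
        simp only [abs_mul, abs_of_pos hαj]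
        calc _ = |G.grad i p j| * G.α j (k j) * (G.α j (k j) * |G.A j j j| * |w|) := by ring
          _ ≤ |G.grad i p j| * G.α j (k j) * (G.α j (k j) * |G.A j j j| * (2 * κ * ‖x - p‖)) := by
            gcongr
          _ = |G.grad i p j| * G.α j (k j) * (G.α j (k j) * |G.A j j j| * (2 * κ)) * ‖x - p‖ := by
            ring
          _ < _ := by
            have := hκA k i j hij
            gcongr
      calc _ ≤ _ := abs_add_le _ _
        _ < |G.grad i p j| * G.α j (k j) * (|G.A j j i| * G.α i (k i) * c / 2) * ‖x - p‖ +
          |G.grad i p j| * G.α j (k j) * (|G.A j j i| * G.α i (k i) * c / 2) * ‖x - p‖ :=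
          add_lt_add_of_le_of_lt hS h2
        _ = |G.grad i p j| * (G.α j (k j) * (|G.A j j i| * (G.α i (k i) * (c * ‖x - p‖)))) := by
          ring
        _ ≤ |G.grad i p j| * (G.α j (k j) * (|G.A j j i| * (G.α i (k i) * |z|))) := by gcongr
        _ = _ := by simp only [abs_mul, abs_of_pos hαj, abs_of_pos hαi]
    refine pos_of_mul_pos_right (a := G.α j (k j) * G.α i (k i)) ?_ (by positivity)
    linarith

end System

/-! ### Periodic functions and the continuous envelope -/

theorem exists_bound_of_periodic {f : ℝ → ℝ} {T : ℝ} (hf : Continuous f)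
    (hp : Function.Periodic f T) (hT : T ≠ 0) : ∃ B, ∀ θ, |f θ| ≤ B := by
  obtain ⟨B, hB⟩ := (hp.compact_of_continuous hT hf).isBounded.exists_norm_le
  exact ⟨B, fun θ => hB _ ⟨θ, rfl⟩⟩

theorem exists_pos_le_of_periodic {f : ℝ → ℝ} {T : ℝ} (hf : Continuous f)
    (hp : Function.Periodic f T) (hT : T ≠ 0) (hpos : ∀ θ, 0 < f θ) :
    ∃ m > 0, ∀ θ, m ≤ f θ := by
  obtain ⟨_, ⟨θ, rfl⟩, h⟩ := (hp.compact_of_continuous hT hf).exists_isLeast ⟨f 0, 0, rfl⟩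
  exact ⟨f θ, hpos θ, fun θ' => h ⟨θ', rfl⟩⟩

/-- The expression is a nonzero multiple of `cos (θ - arg (a + b i))`, whose zeros are countable. It
makes the active mode unique at almost every phase. -/
theorem ae_trig_ne_zero {a b : ℝ} (h : a ≠ 0 ∨ b ≠ 0) :
    ∀ᵐ θ : ℝ, a * Real.cos θ + b * Real.sin θ ≠ 0 := by
  set z : ℂ := ⟨a, b⟩ with hz
  have hz0 : z ≠ 0 := by
    intro h0
    have h1 := congrArg Complex.re h0
    have h2 := congrArg Complex.im h0
    simp [hz] at h1 h2
    tauto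
  have hc : (range fun n : ℤ => z.arg + (2 * n + 1) * Real.pi / 2).Countable := countable_range _
  filter_upwards [hc.ae_notMem MeasureTheory.volume] with θ hθ h0
  apply hθ
  have e : ‖z‖ * Real.cos (θ - z.arg) = 0 := by
    rw [Real.cos_sub]
    have h1 := Complex.norm_mul_cos_arg z
    have h2 := Complex.norm_mul_sin_arg z
    simp only [hz] at h1 h2
    rw [← h0]
    linear_combination Real.cos θ * h1 + Real.sin θ * h2
  have e' := (mul_eq_zero.1 e).resolve_left (norm_ne_zero_iff.2 hz0)
  obtain ⟨n, hn⟩ := Real.cos_eq_zero_iff.1 e'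
  exact ⟨n, by simp only; linarith⟩

/-- If a selection `θ ↦ f (K θ) θ` from a finite family of periodic functions has negative
integral, and `K θ` is for almost every `θ` the only index without violation, then some continuous
periodic function with negative integral dominates all members with small violation. -/
theorem exists_envelope {ι : Type*} [Fintype ι] [Nonempty ι] {f v : ι → ℝ → ℝ} {K : ℝ → ι}
    {T θ₀ : ℝ} (hT : 0 < T)
    (hf : ∀ k, Continuous (f k)) (hfp : ∀ k, Function.Periodic (f k) T)
    (hv : ∀ k, Continuous (v k)) (hvp : ∀ k, Function.Periodic (v k) T)
    (hv0 : ∀ k θ, 0 ≤ v k θ) (hK : ∀ θ, v (K θ) θ = 0)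
    (hsep : ∀ᵐ θ : ℝ, ∀ k, v k θ = 0 → k = K θ)
    (hint : ∫ θ in θ₀..(θ₀ + T), f (K θ) θ < 0) :
    ∃ φ : ℝ → ℝ, Continuous φ ∧ Function.Periodic φ T ∧ (∫ θ in θ₀..(θ₀ + T), φ θ < 0) ∧
      ∃ ε > 0, ∀ k θ, v k θ ≤ ε → f k θ ≤ φ θ := by
  have hne : (Finset.univ : Finset ι).Nonempty := Finset.univ_nonempty
  -- Penalization: as `n` grows, modes with positive violation drop out of the maximum, so at almost
  -- every phase only `K θ` survives and dominated convergence applies. The summand `1 / (n + 1)`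
  -- pays for a violation of up to `1 / (n + 1) ^ 2`, the final tolerance.
  set φ : ℕ → ℝ → ℝ := fun n θ =>
    Finset.univ.sup' hne (fun k => f k θ - n * v k θ) + 1 / ((n : ℝ) + 1) with hφ
  have hφc : ∀ n, Continuous (φ n) := fun n =>
    (Continuous.finset_sup'_apply hne fun k _ => (hf k).sub ((hv k).const_mul _)).add
      continuous_const
  have hle : ∀ (n : ℕ) k θ, f k θ - n * v k θ + 1 / ((n : ℝ) + 1) ≤ φ n θ := fun n k θ =>
    add_le_add_left (Finset.le_sup' (fun k => f k θ - n * v k θ) (Finset.mem_univ k)) _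
  choose B hB using fun k => exists_bound_of_periodic (hf k) (hfp k) hT.ne'
  have hBB : ∀ k θ, |f k θ| ≤ ∑ l, |B l| := fun k θ => (hB k θ).trans
    ((le_abs_self _).trans (Finset.single_le_sum (f := fun l => |B l|)
      (fun l _ => abs_nonneg _) (Finset.mem_univ k)))
  have h01 : ∀ n : ℕ, 0 ≤ 1 / ((n : ℝ) + 1) ∧ 1 / ((n : ℝ) + 1) ≤ 1 := fun n =>
    ⟨by positivity, by rw [div_le_one (by positivity)]; linarith [n.cast_nonneg (α := ℝ)]⟩
  have hlim : Tendsto (fun n : ℕ => ∫ θ in θ₀..(θ₀ + T), φ n θ) atTop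
      (𝓝 (∫ θ in θ₀..(θ₀ + T), f (K θ) θ)) := by
    refine intervalIntegral.tendsto_integral_filter_of_dominated_convergence
      (fun _ => ∑ l, |B l| + 1) (Eventually.of_forall fun n : ℕ => (hφc n).aestronglyMeasurable)
      (Eventually.of_forall fun n : ℕ => Eventually.of_forall fun θ _ => ?_)
      (by simp) (hsep.mono fun θ hθ _ => ?_)
    · rw [Real.norm_eq_abs, abs_le]
      constructor
      · have h1 := hle n (K θ) θ
        rw [hK] at h1
        have h2 := (abs_le.1 (hBB (K θ) θ)).1
        linarith [h01 n]
      · refine add_le_add (Finset.sup'_le _ _ fun k _ => ?_) (h01 n).2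
        have h2 := (abs_le.1 (hBB k θ)).2
        have := mul_nonneg n.cast_nonneg (hv0 k θ) (α := ℝ)
        linarith
    · have hev : ∀ᶠ n : ℕ in atTop, ∀ k, f k θ - n * v k θ ≤ f (K θ) θ := by
        refine eventually_all.2 fun k => ?_
        by_cases hk : v k θ = 0
        · rw [← hθ k hk]; simp [hk]
        have hpos := lt_of_le_of_ne (hv0 k θ) (Ne.symm hk)
        filter_upwards [tendsto_natCast_atTop_atTop.eventually_ge_atTop
          ((f k θ - f (K θ) θ) / v k θ)] with n hn
        rw [div_le_iff₀ hpos] at hn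
        linarith
      have h1 : Tendsto (fun n : ℕ => f (K θ) θ + 1 / ((n : ℝ) + 1)) atTop (𝓝 (f (K θ) θ)) := by
        simpa using tendsto_one_div_add_atTop_nhds_zero_nat.const_add (f (K θ) θ)
      refine h1.congr' (hev.mono fun n hn => ?_)
      simp only [hφ]
      congr 1
      refine le_antisymm ?_ (Finset.sup'_le _ _ fun k _ => hn k)
      have := Finset.le_sup' (fun k => f k θ - n * v k θ) (Finset.mem_univ (K θ))
      rwa [hK, mul_zero, sub_zero] at this
  obtain ⟨n, hn⟩ := (hlim.eventually_lt_const hint).exists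
  refine ⟨φ n, hφc n, fun θ => ?_, hn, 1 / ((n : ℝ) + 1) ^ 2, by positivity, fun k θ hk => ?_⟩
  · simp only [hφ, hfp _ θ, hvp _ θ]
  · have h1 := hle n k θ
    have h2 : n * v k θ ≤ 1 / ((n : ℝ) + 1) := by
      calc n * v k θ ≤ ((n : ℝ) + 1) * (1 / ((n : ℝ) + 1) ^ 2) := by
            have := hv0 k θ
            gcongr
            linarith
        _ = _ := by field_simp
    linarith

/-! ### Polar coordinates and the phase-corrected squared radius -/

/-- The displacement `y` as a complex number. -/
def toComplex : Plane →L[ℝ] ℂ :=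
  Complex.ofRealCLM.comp (ContinuousLinearMap.proj 0) +
    Complex.I • Complex.ofRealCLM.comp (ContinuousLinearMap.proj 1)

theorem toComplex_re (y : Plane) : (toComplex y).re = y 0 := by
  simp [toComplex]

theorem toComplex_im (y : Plane) : (toComplex y).im = y 1 := by
  simp [toComplex]

theorem toComplex_ne_zero {y : Plane} (hy : y ≠ 0) : toComplex y ≠ 0 := by
  intro h
  apply hy
  have h0 := toComplex_re y
  have h1 := toComplex_im y
  rw [h] at h0 h1
  funext i
  fin_cases i
  · exact h0.symm
  · exact h1.symm

/-- The phase of `y`. -/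
def phase (y : Plane) : ℝ := (toComplex y).arg

theorem eq_smul_unitVec (y : Plane) : y = ‖toComplex y‖ • System.unitVec (phase y) := by
  have h0 := Complex.norm_mul_cos_arg (toComplex y)
  have h1 := Complex.norm_mul_sin_arg (toComplex y)
  rw [toComplex_re] at h0
  rw [toComplex_im] at h1
  funext i
  fin_cases i
  · simpa [System.unitVec, phase] using h0.symm
  · simpa [System.unitVec, phase] using h1.symm

theorem norm_toComplex_sq (y : Plane) : ‖toComplex y‖ ^ 2 = y 0 ^ 2 + y 1 ^ 2 := by
  rw [Complex.sq_norm, Complex.normSq_apply, toComplex_re, toComplex_im]; ring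

theorem norm_le_norm_toComplex (y : Plane) : ‖y‖ ≤ ‖toComplex y‖ := by
  refine (pi_norm_le_iff_of_nonneg (norm_nonneg _)).2 fun i => ?_
  have h0 := Complex.abs_re_le_norm (toComplex y)
  have h1 := Complex.abs_im_le_norm (toComplex y)
  rw [toComplex_re] at h0
  rw [toComplex_im] at h1
  fin_cases i
  · exact h0
  · exact h1

theorem norm_toComplex_sq_le (y : Plane) : ‖toComplex y‖ ^ 2 ≤ 2 * ‖y‖ ^ 2 := by
  rw [norm_toComplex_sq]
  have h : ∀ i, y i ^ 2 ≤ ‖y‖ ^ 2 := fun i => by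
    rw [← sq_abs]; exact pow_le_pow_left₀ (abs_nonneg _) (norm_le_pi_norm y i) 2
  linarith [h 0, h 1]

/-- The jump of `arg` on the negative real axis is by `2π`, hence invisible to a periodic function.
On the slit plane the chain rule applies; elsewhere `arg (-w) + π` is used instead of `arg w`. -/
theorem hasFDerivAt_periodic_arg {Ψ ψ : ℝ → ℝ} (hΨ : ∀ θ, HasDerivAt Ψ (ψ θ) θ)
    (hΨp : Function.Periodic Ψ (2 * Real.pi)) (hψp : Function.Periodic ψ (2 * Real.pi))
    {z : ℂ} (hz : z ≠ 0) :
    HasFDerivAt (fun w : ℂ => Ψ w.arg)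
      (ψ z.arg • Complex.imCLM.comp (z⁻¹ • (1 : ℂ →L[ℝ] ℂ))) z := by
  have base : ∀ w ∈ Complex.slitPlane, HasFDerivAt Complex.arg
      (Complex.imCLM.comp (w⁻¹ • (1 : ℂ →L[ℝ] ℂ))) w := fun w hw => by
    have h := Complex.imCLM.hasFDerivAt.comp w (Complex.hasStrictFDerivAt_log_real hw).hasFDerivAt
    exact h.congr_of_eventuallyEq (Eventually.of_forall fun u => by simp [Complex.log_im])
  rcases Complex.mem_slitPlane_or_neg_mem_slitPlane hz with h | h
  · exact (hΨ _).comp_hasFDerivAt z (base z h)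
  · have hrot : ∀ {F : ℝ → ℝ}, Function.Periodic F (2 * Real.pi) → ∀ w : ℂ, w ≠ 0 →
        F w.arg = F ((-w).arg + Real.pi) := by
      intro F hF w hw
      have h1 := Complex.arg_neg_coe_angle (neg_ne_zero.2 hw)
      rw [neg_neg, ← Real.Angle.coe_add, Real.Angle.angle_eq_iff_two_pi_dvd_sub] at h1
      obtain ⟨n, hn⟩ := h1
      have : w.arg = (-w).arg + Real.pi + n * (2 * Real.pi) := by linarith
      rw [this]
      simpa using hF.int_mul n ((-w).arg + Real.pi)
    have h1 : HasFDerivAt (fun w : ℂ => Ψ ((-w).arg + Real.pi))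
        (ψ ((-z).arg + Real.pi) • (Complex.imCLM.comp ((-z)⁻¹ • (1 : ℂ →L[ℝ] ℂ))).comp
          (-ContinuousLinearMap.id ℝ ℂ)) z := by
      have h2 : HasFDerivAt (fun w : ℂ => (-w).arg + Real.pi)
          ((Complex.imCLM.comp ((-z)⁻¹ • (1 : ℂ →L[ℝ] ℂ))).comp
          (-ContinuousLinearMap.id ℝ ℂ)) z :=
        (HasFDerivAt.comp z (base (-z) h) (hasFDerivAt_id z).neg).add_const Real.pi
      exact (hΨ _).comp_hasFDerivAt z h2
    have h3 := h1.congr_of_eventuallyEq (f₁ := fun w : ℂ => Ψ w.arg) <|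
      (isOpen_ne.eventually_mem hz).mono fun w hw => hrot hΨp w hw
    rw [hrot hψp z hz]
    refine h3.congr_fderiv ?_
    ext v
    simp [inv_neg]
    ring

/-- The function `|y|² exp (-2 Ψ (arg y))`. -/
def lyap (Ψ : ℝ → ℝ) (y : Plane) : ℝ := ‖toComplex y‖ ^ 2 * Real.exp (-2 * Ψ (phase y))

theorem lyap_bounds {Ψ : ℝ → ℝ} {B : ℝ} (hB : ∀ θ, |Ψ θ| ≤ B) (y : Plane) :
    Real.exp (-2 * B) * ‖y‖ ^ 2 ≤ lyap Ψ y ∧ lyap Ψ y ≤ 2 * Real.exp (2 * B) * ‖y‖ ^ 2 := by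
  have h := abs_le.1 (hB (phase y))
  have h1 := pow_le_pow_left₀ (norm_nonneg _) (norm_le_norm_toComplex y) 2
  have h2 := norm_toComplex_sq_le y
  have e1 : Real.exp (-2 * B) ≤ Real.exp (-2 * Ψ (phase y)) := Real.exp_le_exp.2 (by linarith)
  have e2 : Real.exp (-2 * Ψ (phase y)) ≤ Real.exp (2 * B) := Real.exp_le_exp.2 (by linarith)
  unfold lyap
  constructor
  · rw [mul_comm]; gcongr
  · calc _ ≤ (2 * ‖y‖ ^ 2) * Real.exp (2 * B) := by gcongr
      _ = _ := by ring

/-- Away from the origin this is the product rule with `d arg = det [y, v] / |y|²`. At the origin,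
where the phase is discontinuous, boundedness of `Ψ` makes the function `O(‖y‖²)`, so its derivative
is `0`. -/
theorem hasFDerivAt_lyap {Ψ ψ : ℝ → ℝ} (hΨ : ∀ θ, HasDerivAt Ψ (ψ θ) θ)
    (hΨp : Function.Periodic Ψ (2 * Real.pi)) (hψp : Function.Periodic ψ (2 * Real.pi))
    (y : Plane) :
    ∃ L : Plane →L[ℝ] ℝ, HasFDerivAt (lyap Ψ) L y ∧ ∀ v, L v =
      2 * Real.exp (-2 * Ψ (phase y)) *
        (y 0 * v 0 + y 1 * v 1 - ψ (phase y) * (y 0 * v 1 - v 0 * y 1)) := by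
  by_cases hy : y = 0
  · subst hy
    have hc : Continuous Ψ := continuous_iff_continuousAt.2 fun θ => (hΨ θ).continuousAt
    obtain ⟨B, hB⟩ := exists_bound_of_periodic hc hΨp (by positivity)
    refine ⟨0, ?_, by simp⟩
    refine Asymptotics.IsBigO.hasFDerivAt (n := 2) ?_ (by norm_num)
    refine Asymptotics.IsBigO.of_bound (2 * Real.exp (2 * B)) (Eventually.of_forall fun x => ?_)
    have h := (lyap_bounds hB x).2
    have h0 : 0 ≤ lyap Ψ x := by unfold lyap; positivity
    rw [Real.norm_of_nonneg h0, sub_zero, Real.norm_of_nonneg (by positivity)]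
    exact h
  have hz := toComplex_ne_zero hy
  have hn : 0 < y 0 ^ 2 + y 1 ^ 2 := by
    rw [← norm_toComplex_sq]; have := norm_pos_iff.2 hz; positivity
  have h1 : HasFDerivAt (fun x : Plane => Ψ (phase x)) _ y :=
    (hasFDerivAt_periodic_arg hΨ hΨp hψp hz).comp y toComplex.hasFDerivAt
  have h2 := (h1.const_mul (-2)).exp
  have p0 : HasFDerivAt (fun x : Plane => x 0) (ContinuousLinearMap.proj 0 : Plane →L[ℝ] ℝ) y :=
    (ContinuousLinearMap.proj 0 : Plane →L[ℝ] ℝ).hasFDerivAt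
  have p1 : HasFDerivAt (fun x : Plane => x 1) (ContinuousLinearMap.proj 1 : Plane →L[ℝ] ℝ) y :=
    (ContinuousLinearMap.proj 1 : Plane →L[ℝ] ℝ).hasFDerivAt
  have h3 := ((p0.mul p0).add (p1.mul p1)).mul h2
  refine ⟨_, h3.congr_of_eventuallyEq (Eventually.of_forall fun x => ?_), fun v => ?_⟩
  · simp only [lyap, norm_toComplex_sq, Pi.add_apply, Pi.mul_apply]; ring
  · have him : ((toComplex y)⁻¹ * toComplex v).im =
        (y 0 * v 1 - v 0 * y 1) / (y 0 ^ 2 + y 1 ^ 2) := by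
      rw [Complex.mul_im, Complex.inv_re, Complex.inv_im, Complex.normSq_apply]
      simp only [toComplex_re, toComplex_im]
      field_simp
      ring
    simp only [phase, add_apply, smul_apply,
      ContinuousLinearMap.comp_apply, ContinuousLinearMap.proj_apply, smul_eq_mul,
      Complex.imCLM_apply, one_apply_eq_self, Pi.add_apply, Pi.mul_apply, him]
    field_simp
    ring

/-! ### Rotation of all modes and the strict Lyapunov function -/

namespace System

variable (G : System)

theorem unitVec_periodic : Function.Periodic unitVec (2 * Real.pi) := fun θ => by
  simp [unitVec]

theorem continuous_unitVec : Continuous unitVec := by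
  unfold unitVec
  refine continuous_pi fun i => ?_
  fin_cases i
  · exact Real.continuous_cos
  · exact Real.continuous_sin

/-- The angular momentum `det [y, 𝔸_k y]`. -/
def swirl (k : Mode) (y : Plane) : ℝ :=
  y 0 * (G.α 1 (k 1) * G.marginal 1 y) - G.α 0 (k 0) * G.marginal 0 y * y 1

theorem continuous_swirl (k : Mode) : Continuous (G.swirl k) := by
  have h0 := G.continuous_marginal 0
  have h1 := G.continuous_marginal 1
  unfold swirl; fun_prop

/-- `swirl` is a quadratic form whose discriminant is that of the characteristic polynomial, which
is negative. Completing the square shows that it is definite, with the sign of `G.A 1 0 1`. -/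
theorem swirl_pos (hG : G.HasComplexEigenvalues) (k : Mode) {y : Plane} (hy : y ≠ 0) :
    0 < G.A 1 0 1 * G.swirl k y := by
  have hd := G.discrim_neg hG k
  have hs := G.A_comm 1 0 1
  have hc : 0 < G.A 1 0 1 ^ 2 := by
    refine sq_pos_of_ne_zero fun h => ?_
    have := G.coupling_neg hG
    simp [h] at this
  have h1 := G.α_pos 1 (k 1)
  set a := G.α 0 (k 0)
  set d := G.α 1 (k 1)
  set D := (a * G.A 0 0 0 - d * G.A 1 1 1) ^ 2 + 4 * (a * d) * (G.A 0 0 1 * G.A 1 0 1) with hD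
  have key : 4 * d * (G.A 1 0 1 * G.swirl k y) =
      (2 * d * G.A 1 0 1 * y 0 + (d * G.A 1 1 1 - a * G.A 0 0 0) * y 1) ^ 2 - D * y 1 ^ 2 := by
    simp only [swirl, marginal, hD, hs]
    ring
  refine pos_of_mul_pos_right (a := 4 * d) ?_ (by positivity)
  rw [key]
  by_cases h : y 1 = 0
  · have h0 : y 0 ≠ 0 := fun h0 => hy (by funext i; fin_cases i <;> simp [h0, h])
    have e0 := sq_pos_of_ne_zero h0
    have : 0 < 4 * d ^ 2 * (G.A 1 0 1 ^ 2 * y 0 ^ 2) := by positivity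
    rw [h]
    linarith
  · have e1 := sq_pos_of_ne_zero h
    have := mul_pos (neg_pos.2 hd) e1
    have := sq_nonneg (2 * d * G.A 1 0 1 * y 0 + (d * G.A 1 1 1 - a * G.A 0 0 0) * y 1)
    linarith

theorem unitVec_ne_zero (θ : ℝ) : unitVec θ ≠ 0 := by
  intro h
  have h0 : Real.cos θ = 0 := by simpa [unitVec] using congrFun h 0
  have h1 : Real.sin θ = 0 := by simpa [unitVec] using congrFun h 1
  have := Real.sin_sq_add_cos_sq θ
  simp [h0, h1] at this

theorem radialRate_eq (k : Mode) (θ : ℝ) :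
    G.radialRate k θ = (unitVec θ 0 * (G.α 0 (k 0) * G.marginal 0 (unitVec θ)) +
      unitVec θ 1 * (G.α 1 (k 1) * G.marginal 1 (unitVec θ))) / G.swirl k (unitVec θ) := by
  simp only [radialRate, Matrix.det_fin_two_of, sysMatrix_mulVec, dotProduct, Fin.sum_univ_two,
    swirl]

theorem rateGrad_dotProduct {p : Plane} (hp : G.IsNash p) (k : Mode) (y : Plane) {i j : Fin 2}
    (hij : i ≠ j) :
    G.rateGrad p i k ⬝ᵥ y = G.grad i p j * (G.α j (k j) * G.marginal j y) := by
  rw [rateGrad, Matrix.mulVec_transpose, ← Matrix.dotProduct_mulVec, dotProduct, Fin.sum_univ_two]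
  have h := hp.grad_eq_zero i
  simp only [sysMatrix_mulVec]
  fin_cases i <;> fin_cases j <;> simp_all

/-- A differentiable function of the displacement which is comparable to the squared norm and
decays (`τ = 1`) or grows (`τ = -1`) exponentially along every weakly active mode near `p`. -/
theorem exists_lyapunov {p : Plane} (hp : G.IsNash p) (hG : G.HasComplexEigenvalues)
    (hg : ∀ i j, i ≠ j → G.grad i p j ≠ 0) {K : ℝ → Mode} (hK : G.IsActiveMode p K) {θ₀ τ : ℝ}
    (hτ : τ = 1 ∨ τ = -1) (hγ : τ * (G.A 1 0 1 * G.radialGrowth K θ₀) < 0) :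
    ∃ W : Plane → ℝ, ∃ m > 0, ∃ M > 0, ∃ c > 0, ∃ r > 0, Continuous W ∧
      (∀ y, m * ‖y‖ ^ 2 ≤ W y ∧ W y ≤ M * ‖y‖ ^ 2) ∧
      ∀ (x : ℝ → Plane) (k : Mode) (t : ℝ), dist (x t) p < r →
        (∀ i, SignOK (k i) (G.payoffRate i k (x t))) → HasDerivAt x (G.field k (x t)) t →
        ∃ D, HasDerivAt (fun u => W (x u - p)) D t ∧ τ * D ≤ -c * W (x t - p) := by
  -- `σ` is the common direction of rotation. It converts growth per unit of phase into growth in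
  -- time, and `τ` reduces the growing case to a negative integral as well.
  obtain ⟨σ, hσ, hσA⟩ : ∃ σ : ℝ, (σ = 1 ∨ σ = -1) ∧ 0 < σ * G.A 1 0 1 := by
    rcases lt_trichotomy (G.A 1 0 1) 0 with h | h | h
    · exact ⟨-1, Or.inr rfl, by linarith⟩
    · have := G.coupling_neg hG
      simp [h] at this
    · exact ⟨1, Or.inl rfl, by linarith⟩
  have hσσ : σ * σ = 1 := by rcases hσ with rfl | rfl <;> norm_num
  have hττ : τ * τ = 1 := by rcases hτ with rfl | rfl <;> norm_num
  have hswirl : ∀ k θ, 0 < σ * G.swirl k (unitVec θ) := fun k θ => by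
    refine pos_of_mul_pos_right (a := σ * G.A 1 0 1) ?_ hσA.le
    have := G.swirl_pos hG k (unitVec_ne_zero θ)
    calc (0 : ℝ) < G.A 1 0 1 * G.swirl k (unitVec θ) := this
      _ = σ * G.A 1 0 1 * (σ * G.swirl k (unitVec θ)) := by
        linear_combination (-G.A 1 0 1 * G.swirl k (unitVec θ)) * hσσ
  have hsw0 : ∀ k θ, G.swirl k (unitVec θ) ≠ 0 := fun k θ h => by
    have := hswirl k θ
    simp [h] at this
  -- the data of the envelope
  set f : Mode → ℝ → ℝ := fun k θ => τ * σ * G.radialRate k θ with hf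
  set viol : (Fin 2 → Fin 2 → Level → Plane → ℝ) := fun i j ℓ y =>
    max 0 (-(ℓ.sgn * (G.grad i p j * G.marginal j y))) with hviol
  set v : Mode → ℝ → ℝ := fun k θ =>
    viol 0 1 (k 0) (unitVec θ) + viol 1 0 (k 1) (unitVec θ) with hv
  have hper : ∀ F : Plane → ℝ, Function.Periodic (fun θ => F (unitVec θ)) (2 * Real.pi) :=
    fun F => unitVec_periodic.comp F
  have hmc := G.continuous_marginal
  have huc := continuous_unitVec
  have hrad : ∀ k, Continuous (G.radialRate k) := fun k => by
    have h1 : ∀ i, Continuous fun θ => unitVec θ i := fun i => (continuous_apply i).comp huc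
    have h2 : ∀ i, Continuous fun θ => G.marginal i (unitVec θ) := fun i => (hmc i).comp huc
    simp only [funext (G.radialRate_eq k)]
    exact (((h1 0).mul ((h2 0).const_mul _)).add ((h1 1).mul ((h2 1).const_mul _))).div
      ((G.continuous_swirl k).comp huc) (hsw0 k)
  have hradp : ∀ k, Function.Periodic (G.radialRate k) (2 * Real.pi) := fun k θ => by
    rw [radialRate_eq, radialRate_eq, unitVec_periodic]
  have hvc : ∀ k, Continuous (v k) := fun k => by
    have h : ∀ i j ℓ, Continuous fun θ => viol i j ℓ (unitVec θ) := fun i j ℓ =>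
      continuous_const.max ((((hmc j).comp huc).const_mul _).const_mul _).neg
    exact (h _ _ _).add (h _ _ _)
  have hmode : ∀ θ i j, i ≠ j → 0 ≤ (K θ i).sgn * (G.grad i p j * G.marginal j (unitVec θ)) := by
    intro θ i j hij
    have h := hK θ 1 one_pos i
    rw [signOK_iff, one_smul, add_sub_cancel_left, G.rateGrad_dotProduct hp _ _ hij] at h
    refine nonneg_of_mul_nonneg_right (a := G.α j (K θ j)) ?_ (G.α_pos _ _)
    linarith
  obtain ⟨φ, hφc, hφp, hφint, ε, hε, hφ⟩ := exists_envelope (f := f) (v := v) (K := K)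
    (T := 2 * Real.pi) (θ₀ := θ₀) (by positivity) (fun k => (hrad k).const_mul _)
    (fun k θ => by simp only [hf, hradp k θ]) hvc (fun k => hper fun y =>
      viol 0 1 (k 0) y + viol 1 0 (k 1) y)
    (fun k θ => add_nonneg (le_max_left _ _) (le_max_left _ _))
    (fun θ => by
      simp only [hv, hviol]
      rw [max_eq_left (neg_nonpos.2 (hmode θ 0 1 (by decide))),
        max_eq_left (neg_nonpos.2 (hmode θ 1 0 (by decide))), add_zero])
    (by
      have h0 : ∀ i : Fin 2, ∀ᵐ θ : ℝ, G.marginal i (unitVec θ) ≠ 0 := fun i => by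
        have : G.A i i 0 ≠ 0 ∨ G.A i i 1 ≠ 0 := by
          have := (G.A_concave i).ne
          fin_cases i
          · exact Or.inl this
          · exact Or.inr this
        simpa [marginal, unitVec] using ae_trig_ne_zero this
      filter_upwards [h0 0, h0 1] with θ e0 e1 k hk
      have e : ∀ i, G.marginal i (unitVec θ) ≠ 0 := fun i => by fin_cases i <;> assumption
      have hk0 : ∀ i j, i ≠ j → 0 ≤ (k i).sgn * (G.grad i p j * G.marginal j (unitVec θ)) := by
        have a0 := le_max_left 0 (-((k 0).sgn * (G.grad 0 p 1 * G.marginal 1 (unitVec θ))))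
        have a1 := le_max_left 0 (-((k 1).sgn * (G.grad 1 p 0 * G.marginal 0 (unitVec θ))))
        have b0 := le_max_right 0 (-((k 0).sgn * (G.grad 0 p 1 * G.marginal 1 (unitVec θ))))
        have b1 := le_max_right 0 (-((k 1).sgn * (G.grad 1 p 0 * G.marginal 0 (unitVec θ))))
        simp only [hv, hviol] at hk
        intro i j hij
        fin_cases i <;> fin_cases j <;> simp only [ne_eq, not_true_eq_false] at hij <;>
          simp only [Fin.zero_eta, Fin.mk_one] <;> linarith
      funext i
      by_contra hne
      obtain ⟨j, hij⟩ : ∃ j, i ≠ j := ⟨i + 1, by fin_cases i <;> decide⟩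
      have h1 := hk0 i j hij
      have h2 := hmode θ i j hij
      rw [Level.eq_flip_of_ne hne, Level.sgn_flip] at h1
      have h3 : (K θ i).sgn * (G.grad i p j * G.marginal j (unitVec θ)) = 0 := by linarith
      rcases (K θ i).sgn_eq with hs | hs <;> rw [hs] at h3 <;>
        simp [hg i j hij, e j] at h3)
    (by
      have : (∫ θ in θ₀..(θ₀ + 2 * Real.pi), f (K θ) θ) = τ * σ * G.radialGrowth K θ₀ := by
        simp only [hf, intervalIntegral.integral_const_mul, radialGrowth]
      rw [this]
      refine neg_of_mul_neg_right (a := σ * G.A 1 0 1) ?_ hσA.le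
      calc σ * G.A 1 0 1 * (τ * σ * G.radialGrowth K θ₀)
          = τ * (G.A 1 0 1 * G.radialGrowth K θ₀) := by
            linear_combination (G.A 1 0 1 * τ * G.radialGrowth K θ₀) * hσσ
        _ < 0 := hγ)
  -- the phase correction
  have h2pi : (0 : ℝ) < 2 * Real.pi := by positivity
  set avg := (∫ θ in θ₀..(θ₀ + 2 * Real.pi), φ θ) / (2 * Real.pi) with havg
  have havg0 : avg < 0 := div_neg_of_neg_of_pos hφint h2pi
  set ψ : ℝ → ℝ := fun θ => τ * σ * (φ θ - avg) with hψ
  have hψc : Continuous ψ := (hφc.sub continuous_const).const_mul _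
  have hψp : Function.Periodic ψ (2 * Real.pi) := fun θ => by simp only [hψ, hφp θ]
  set Ψ : ℝ → ℝ := fun θ => ∫ s in (0 : ℝ)..θ, ψ s with hΨ
  have hΨd : ∀ θ, HasDerivAt Ψ (ψ θ) θ := fun θ =>
    (hψc.integral_hasStrictDerivAt 0 θ).hasDerivAt
  have hΨp : Function.Periodic Ψ (2 * Real.pi) := by
    intro θ
    -- Subtracting `avg` leaves mean zero over a period, which is what makes the primitive `Ψ`
    -- periodic.
    have h1 : ∫ s in θ..(θ + 2 * Real.pi), ψ s = 0 := by
      rw [hψp.intervalIntegral_add_eq θ θ₀]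
      simp only [hψ, intervalIntegral.integral_const_mul]
      rw [intervalIntegral.integral_sub (hφc.intervalIntegrable _ _) (by simp)]
      simp only [intervalIntegral.integral_const, add_sub_cancel_left, smul_eq_mul, havg]
      field_simp
      ring
    have h2 := intervalIntegral.integral_add_adjacent_intervals
      (hψc.intervalIntegrable 0 θ) (hψc.intervalIntegrable (μ := MeasureTheory.volume) θ
        (θ + 2 * Real.pi))
    simp only [hΨ, ← h2, h1, add_zero]
  obtain ⟨B, hB⟩ := exists_bound_of_periodic
    (continuous_iff_continuousAt.2 fun θ => (hΨd θ).continuousAt) hΨp h2pi.ne'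
  choose μ hμ0 hμ using fun k => exists_pos_le_of_periodic
    (f := fun θ => σ * G.swirl k (unitVec θ))
    (((G.continuous_swirl k).comp huc).const_mul σ) (hper fun y => σ * G.swirl k y) h2pi.ne'
    (hswirl k)
  obtain ⟨μ₀, hμ₀, hμ₀le⟩ : ∃ μ₀ > 0, ∀ k, μ₀ ≤ μ k :=
    ⟨Finset.univ.inf' Finset.univ_nonempty μ, by simpa [Finset.lt_inf'_iff] using hμ0,
      fun k => Finset.inf'_le _ (Finset.mem_univ k)⟩
  have hnear : ∀ᶠ x in 𝓝 p, ∀ k : Mode, ∀ i j : Fin 2, i ≠ j →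
      |G.payoffRate i k x - G.grad i p j * (G.α j (k j) * G.marginal j (x - p))| ≤
        ε / 2 * G.α j (k j) * ‖x - p‖ := by
    refine eventually_all.2 fun k => eventually_all.2 fun i => eventually_all.2 fun j => ?_
    by_cases hij : i = j
    · simp [hij]
    have : 0 < ε / 2 * G.α j (k j) := mul_pos (by positivity) (G.α_pos _ _)
    filter_upwards [(G.payoffRate_isLittleO hp k hij).bound this] with x hx _
    simpa using hx
  obtain ⟨r, hr, hnear⟩ := Metric.eventually_nhds_iff.1 hnear
  refine ⟨lyap Ψ, Real.exp (-2 * B), Real.exp_pos _, 2 * Real.exp (2 * B), by positivity,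
    2 * μ₀ * -avg, by have := neg_pos.2 havg0; positivity, r, hr,
    continuous_iff_continuousAt.2 fun y =>
      (hasFDerivAt_lyap hΨd hΨp hψp y).choose_spec.1.continuousAt,
    fun y => lyap_bounds hB y, fun x k t hxr hok hx => ?_⟩
  set y := x t - p with hy
  obtain ⟨L, hL, hLv⟩ := hasFDerivAt_lyap hΨd hΨp hψp y
  have hL' : HasFDerivAt (lyap Ψ) L ((fun u => x u - p) t) := hL
  have hcomp := hL'.comp_hasDerivAt t (hx.sub_const p)
  refine ⟨L (G.field k (x t)), hcomp, ?_⟩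
  rw [hLv]
  simp only [hp.field_apply, ← hy]
  set θ := phase y with hθ
  set R := ‖toComplex y‖ with hR
  have hyu : y = R • unitVec θ := eq_smul_unitVec y
  have hR0 : 0 ≤ R := norm_nonneg _
  by_cases hRz : R = 0
  · have hy0 : y = 0 := by rw [hyu, hRz, zero_smul]
    simp [hy0, lyap, toComplex]
  have hRpos : 0 < R := lt_of_le_of_ne hR0 (Ne.symm hRz)
  set e := Real.exp (-2 * Ψ θ) with he
  have hepos : 0 < e := Real.exp_pos _
  have hlyap : lyap Ψ y = R ^ 2 * e := rfl
  -- The actual rates satisfy the sign conditions of `k`. Replacing them by their linear parts costs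
  -- at most `ε / 2` per agent, relative to the radius and the sensitivity, by the choice of `r`.
  have hvk : v k θ ≤ ε := by
    have key : ∀ i j, i ≠ j → viol i j (k i) (unitVec θ) ≤ ε / 2 := by
      intro i j hij
      refine max_le (by positivity) ?_
      have h1 := hnear hxr k i j hij
      have h2 := (signOK_iff _ _).1 (hok i)
      have h3 : G.marginal j (x t - p) = R * G.marginal j (unitVec θ) := by
        rw [← hy, hyu, marginal_smul]
      have h4 : ‖x t - p‖ ≤ R := norm_le_norm_toComplex y
      have hα := G.α_pos j (k j)
      rw [h3] at h1
      have h5 := abs_le.1 (h1.trans (mul_le_mul_of_nonneg_left h4 (by positivity)))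
      have h6 : 0 < G.α j (k j) * R := by positivity
      refine le_of_mul_le_mul_left ?_ h6
      rcases (k i).sgn_eq with hs | hs <;> rw [hs] at h2 ⊢ <;> linarith [h5.1, h5.2]
    have := add_le_add (key 0 1 (by decide)) (key 1 0 (by decide))
    calc v k θ ≤ ε / 2 + ε / 2 := this
      _ = ε := by ring
  have hfφ := hφ k θ hvk
  have hs := hsw0 k θ
  set S := G.swirl k (unitVec θ) with hS
  have hyi : ∀ i, y i = R * unitVec θ i := fun i => by
    conv_lhs => rw [hyu]
    rfl
  have hmi : ∀ i, G.marginal i y = R * G.marginal i (unitVec θ) := fun i => by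
    conv_lhs => rw [hyu]
    exact G.marginal_smul i R _
  have hnum : unitVec θ 0 * (G.α 0 (k 0) * G.marginal 0 (unitVec θ)) +
      unitVec θ 1 * (G.α 1 (k 1) * G.marginal 1 (unitVec θ)) = G.radialRate k θ * S := by
    rw [radialRate_eq, div_mul_cancel₀ _ hs]
  have hDeq : y 0 * (G.α 0 (k 0) * G.marginal 0 y) + y 1 * (G.α 1 (k 1) * G.marginal 1 y) -
      ψ θ * (y 0 * (G.α 1 (k 1) * G.marginal 1 y) - G.α 0 (k 0) * G.marginal 0 y * y 1) =
      R ^ 2 * (S * (G.radialRate k θ - ψ θ)) := by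
    simp only [hyi, hmi]
    simp only [hS, swirl] at hnum ⊢
    linear_combination R ^ 2 * hnum
  rw [hDeq, hlyap]
  -- The envelope cancels the radial rate up to its negative mean, and `σ * S`, the angular speed,
  -- is at least `μ₀`.
  have hmain : τ * (S * (G.radialRate k θ - ψ θ)) ≤ μ₀ * avg := by
    have h1 : τ * (S * (G.radialRate k θ - ψ θ)) = (σ * S) * (f k θ - (φ θ - avg)) := by
      simp only [hf, hψ]
      linear_combination (-τ * S * G.radialRate k θ) * hσσ
        - (σ * S * (φ θ - avg)) * hττ
    rw [h1]
    have h2 : μ₀ ≤ σ * S := (hμ₀le k).trans (hμ k θ)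
    have h3 : f k θ - (φ θ - avg) ≤ avg := by linarith
    have h4 : 0 < σ * S := hμ₀.trans_le h2
    calc (σ * S) * (f k θ - (φ θ - avg)) ≤ (σ * S) * avg := by gcongr
      _ ≤ μ₀ * avg := mul_le_mul_of_nonpos_right h2 havg0.le
  have hpos : 0 ≤ 2 * e * R ^ 2 := by positivity
  calc τ * (2 * e * (R ^ 2 * (S * (G.radialRate k θ - ψ θ))))
      = 2 * e * R ^ 2 * (τ * (S * (G.radialRate k θ - ψ θ))) := by ring
    _ ≤ 2 * e * R ^ 2 * (μ₀ * avg) := by gcongr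
    _ = _ := by ring

end System

/-! ### Lyapunov arguments along trajectories -/

/-- A continuous function whose derivative is nonpositive outside a finite set does not increase. -/
theorem le_of_hasDerivAt_nonpos_off_finset {f : ℝ → ℝ} (F : Finset ℝ) {a b : ℝ} (hab : a ≤ b)
    (hf : ContinuousOn f (Icc a b))
    (hd : ∀ t ∈ Ioo a b, t ∉ F → ∃ D, HasDerivAt f D t ∧ D ≤ 0) : f b ≤ f a := by
  classical
  induction F using Finset.induction_on generalizing a b with
  | empty =>
    have h : AntitoneOn f (Icc a b) := by
      refine antitoneOn_of_deriv_nonpos (convex_Icc a b) hf ?_ ?_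
      · intro t ht
        rw [interior_Icc] at ht
        obtain ⟨D, hD, -⟩ := hd t ht (Finset.notMem_empty t)
        exact hD.differentiableAt.differentiableWithinAt
      · intro t ht
        rw [interior_Icc] at ht
        obtain ⟨D, hD, hD0⟩ := hd t ht (Finset.notMem_empty t)
        rwa [hD.deriv]
    exact h (left_mem_Icc.2 hab) (right_mem_Icc.2 hab) hab
  | insert q F _ ih =>
    by_cases hq : q ∈ Ioo a b
    · refine (ih hq.2.le (hf.mono (Icc_subset_Icc_left hq.1.le)) fun t ht htF => ?_).trans
        (ih hq.1.le (hf.mono (Icc_subset_Icc_right hq.2.le)) fun t ht htF => ?_)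
      · exact hd t ⟨hq.1.trans ht.1, ht.2⟩ (by simp [htF, ht.1.ne'])
      · exact hd t ⟨ht.1, ht.2.trans hq.2⟩ (by simp [htF, ht.2.ne])
    · refine ih hab hf fun t ht htF => hd t ht ?_
      simp only [Finset.mem_insert, htF, or_false]
      rintro rfl
      exact hq ht

namespace System

variable {G : System}

/-- Off a finite set of instants, the mode of a trajectory is weakly active. -/
theorem IsTrajectoryOn.exists_finset {T : ℝ} {x : ℝ → Plane} {s : ℝ → Mode}
    (h : G.IsTrajectoryOn T x s) : ∃ F : Finset ℝ, ∀ t ∈ Ioo 0 T, t ∉ F →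
      HasDerivAt x (G.field (s t) (x t)) t ∧
        ∀ i, SignOK (s t i) (G.payoffRate i (s t) (x t)) := by
  obtain ⟨F, -, hF⟩ := h.piecewise
  refine ⟨F, fun t ht htF => ⟨hF t ht htF, fun i => ?_⟩⟩
  have hd : derivWithin (fun u => G.payoff i (x u)) (Iic t) t = G.payoffRate i (s t) (x t) :=
    (G.hasDerivAt_payoff_comp (hF t ht htF) i).hasDerivWithinAt.derivWithin
      (uniqueDiffWithinAt_Iic t)
  have hl := h.low i t ⟨ht.1, ht.2.le⟩
  have hh := h.high i t ⟨ht.1, ht.2.le⟩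
  rw [hd] at hl hh
  rcases lt_trichotomy (G.payoffRate i (s t) (x t)) 0 with h0 | h0 | h0
  · rw [hl h0]; exact h0.le
  · rw [h0]; cases s t i <;> exact le_rfl
  · rw [hh h0]; exact h0.le

/-- Exponential decay (`τ = 1`) or growth (`τ = -1`) of a Lyapunov function along a trajectory. -/
theorem IsTrajectoryOn.lyapunov_le {T : ℝ} {x : ℝ → Plane} {s : ℝ → Mode}
    (h : G.IsTrajectoryOn T x s) {p : Plane} {W : Plane → ℝ} {τ c r : ℝ} (hτ : τ * τ = 1)
    (hWc : Continuous W)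
    (hW : ∀ (x : ℝ → Plane) (k : Mode) (t : ℝ), dist (x t) p < r →
        (∀ i, SignOK (k i) (G.payoffRate i k (x t))) → HasDerivAt x (G.field k (x t)) t →
        ∃ D, HasDerivAt (fun u => W (x u - p)) D t ∧ τ * D ≤ -c * W (x t - p))
    {t : ℝ} (ht : t ∈ Icc 0 T) (hr : ∀ u ∈ Ioo 0 t, dist (x u) p < r) :
    τ * (W (x t - p) * Real.exp (τ * c * t)) ≤ τ * W (x 0 - p) := by
  obtain ⟨F, hF⟩ := h.exists_finset
  have hx := h.continuousOn.mono (Icc_subset_Icc_right ht.2)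
  have hcont : ContinuousOn (fun u => τ * (W (x u - p) * Real.exp (τ * c * u))) (Icc 0 t) := by
    refine continuousOn_const.mul ((hWc.comp_continuousOn (hx.sub continuousOn_const)).mul ?_)
    exact (by fun_prop : Continuous fun u : ℝ => Real.exp (τ * c * u)).continuousOn
  have := le_of_hasDerivAt_nonpos_off_finset F ht.1 hcont fun u hu huF => by
    obtain ⟨hd, hok⟩ := hF u ⟨hu.1, hu.2.trans_le ht.2⟩ huF
    obtain ⟨D, hD, hDle⟩ := hW x (s u) u (hr u hu) hok hd
    have he : HasDerivAt (fun u : ℝ => Real.exp (τ * c * u))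
        (Real.exp (τ * c * u) * (τ * c)) u := by
      simpa using ((hasDerivAt_id u).const_mul (τ * c)).exp
    refine ⟨_, (hD.mul he).const_mul τ, ?_⟩
    have e : τ * (D * Real.exp (τ * c * u) + W (x u - p) * (Real.exp (τ * c * u) * (τ * c))) =
        Real.exp (τ * c * u) * (τ * D + c * W (x u - p)) := by
      linear_combination (W (x u - p) * Real.exp (τ * c * u) * c) * hτ
    rw [e]
    exact mul_nonpos_of_nonneg_of_nonpos (Real.exp_pos _).le (by linarith)
  simpa using this

theorem isStable_of_lyapunov {p : Plane} {W : Plane → ℝ} {m M c r : ℝ} (hm : 0 < m) (hM : 0 < M)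
    (hc : 0 < c) (hr : 0 < r) (hWc : Continuous W)
    (hWb : ∀ y, m * ‖y‖ ^ 2 ≤ W y ∧ W y ≤ M * ‖y‖ ^ 2)
    (hW : ∀ (x : ℝ → Plane) (k : Mode) (t : ℝ), dist (x t) p < r →
        (∀ i, SignOK (k i) (G.payoffRate i k (x t))) → HasDerivAt x (G.field k (x t)) t →
        ∃ D, HasDerivAt (fun u => W (x u - p)) D t ∧ 1 * D ≤ -c * W (x t - p)) :
    G.IsStable p := by
  intro ε hε
  set ε' := min ε r with hε'
  have hε'0 : 0 < ε' := lt_min hε hr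
  have hev : ∀ᶠ δ in 𝓝[>] (0 : ℝ), δ < ε' ∧ M * δ ^ 2 < m * ε' ^ 2 := by
    apply Filter.Eventually.filter_mono nhdsWithin_le_nhds
    have h2 : Continuous fun δ : ℝ => M * δ ^ 2 := by fun_prop
    exact (eventually_lt_nhds hε'0).and
      (h2.continuousAt.eventually_lt continuousAt_const (by simp; positivity))
  obtain ⟨δ, ⟨hδε, hδ⟩, hδ0 : 0 < δ⟩ := (hev.and self_mem_nhdsWithin).exists
  refine ⟨δ, hδ0, fun T x s hx hx0 => ?_⟩
  suffices h : ∀ t ∈ Icc 0 T, dist (x t) p < ε' from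
    fun t ht => (h t ht).trans_le (min_le_left _ _)
  by_contra hcon
  push Not at hcon
  -- The least element of `Z` is the first exit time. Before it the decay estimate holds, which
  -- contradicts `M * δ ^ 2 < m * ε' ^ 2`.
  set Z := Icc 0 T ∩ (fun t => dist (x t) p) ⁻¹' Ici ε' with hZ
  have hZc : IsClosed Z :=
    ((continuous_id.dist continuous_const).comp_continuousOn
      hx.continuousOn).preimage_isClosed_of_isClosed isClosed_Icc isClosed_Ici
  have hZk : IsCompact Z := isCompact_Icc.of_isClosed_subset hZc inter_subset_left
  obtain ⟨t₁, ht₁, hleast⟩ := hZk.exists_isLeast (by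
    obtain ⟨t, ht, hd⟩ := hcon
    exact ⟨t, ht, hd⟩)
  have hbefore : ∀ u ∈ Ioo 0 t₁, dist (x u) p < r := fun u hu => by
    by_contra hu'
    have : u ∈ Z := ⟨⟨hu.1.le, hu.2.le.trans ht₁.1.2⟩,
      (min_le_right ε r).trans (not_lt.1 hu')⟩
    exact absurd (hleast this) (not_le.2 hu.2)
  have hle := hx.lyapunov_le (by norm_num) hWc hW ht₁.1 hbefore
  have h1 : (1 : ℝ) ≤ Real.exp (1 * c * t₁) :=
    Real.one_le_exp (by have := ht₁.1.1; positivity)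
  have h2 := (hWb (x t₁ - p)).1
  have h3 := (hWb (x 0 - p)).2
  have h4 : ε' ≤ ‖x t₁ - p‖ := by simpa [dist_eq_norm] using ht₁.2
  have h5 : ‖x 0 - p‖ < δ := by simpa [dist_eq_norm] using hx0
  have h6 : m * ε' ^ 2 ≤ W (x t₁ - p) := le_trans (by gcongr) h2
  have h7 : W (x 0 - p) ≤ M * δ ^ 2 := h3.trans (by gcongr)
  have h8 : W (x t₁ - p) ≤ W (x t₁ - p) * Real.exp (1 * c * t₁) :=
    le_mul_of_one_le_right (le_trans (by positivity) h6) h1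
  linarith

theorem IsTrajectory.tendsto_of_lyapunov {p : Plane} {W : Plane → ℝ} {m c r : ℝ}
    (hm : 0 < m) (hc : 0 < c) (hWc : Continuous W) (hWb : ∀ y, m * ‖y‖ ^ 2 ≤ W y)
    (hW : ∀ (x : ℝ → Plane) (k : Mode) (t : ℝ), dist (x t) p < r →
        (∀ i, SignOK (k i) (G.payoffRate i k (x t))) → HasDerivAt x (G.field k (x t)) t →
        ∃ D, HasDerivAt (fun u => W (x u - p)) D t ∧ 1 * D ≤ -c * W (x t - p))
    {x : ℝ → Plane} {s : ℝ → Mode} (h : G.IsTrajectory x s) (hr : ∀ u ≥ 0, dist (x u) p < r) :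
    Tendsto x atTop (𝓝 p) := by
  have hexp : Tendsto (fun t => W (x 0 - p) / m * Real.exp (-(c * t))) atTop (𝓝 0) := by
    have h1 : Tendsto (fun t : ℝ => c * t) atTop atTop := tendsto_id.const_mul_atTop hc
    simpa using (Real.tendsto_exp_neg_atTop_nhds_zero.comp h1).const_mul (W (x 0 - p) / m)
  have hsq : Tendsto (fun t => ‖x t - p‖ ^ 2) atTop (𝓝 0) := by
    refine squeeze_zero' (Eventually.of_forall fun t => by positivity) ?_ hexp
    filter_upwards [eventually_gt_atTop 0] with t ht
    have hle := (h t ht).lyapunov_le (by norm_num) hWc hW (right_mem_Icc.2 ht.le)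
      fun u hu => hr u hu.1.le
    have h1 := hWb (x t - p)
    have h2 : W (x t - p) ≤ W (x 0 - p) * Real.exp (-(c * t)) := by
      rw [Real.exp_neg, ← div_eq_mul_inv, le_div_iff₀ (Real.exp_pos _)]
      simpa using hle
    rw [div_mul_eq_mul_div, le_div_iff₀ hm]
    linarith
  have hn : Tendsto (fun t => ‖x t - p‖) atTop (𝓝 0) := by
    have := hsq.sqrt
    simpa [Real.sqrt_sq] using this
  exact tendsto_iff_norm_sub_tendsto_zero.2 hn

end System

/-! ### Signs and first zeros of scalar functions -/

theorem Level.exists_sgn_mul_pos {a : ℝ} (ha : a ≠ 0) : ∃ ℓ : Level, 0 < ℓ.sgn * a := by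
  rcases lt_or_gt_of_ne ha with h | h
  · exact ⟨Level.L, by simpa [Level.sgn] using h⟩
  · exact ⟨Level.H, by simpa [Level.sgn] using h⟩

theorem eq_of_ne_of_ne {i j l : Fin 2} (hij : i ≠ j) (hl : l ≠ i) : l = j := by
  omega

theorem exists_other (i : Fin 2) : ∃ j, i ≠ j :=
  ⟨i + 1, by fin_cases i <;> decide⟩

/-- Transfer of a sign through a common factor. -/
theorem pos_mul_of_pos_mul_of_pos_mul {a b c : ℝ} (h : 0 < a * b) (h' : 0 < b * c) : 0 < a * c := by
  have hb : 0 < b ^ 2 := sq_pos_of_ne_zero fun h0 => by simp [h0] at h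
  refine pos_of_mul_pos_right (a := b ^ 2) ?_ hb.le
  calc 0 < (a * b) * (b * c) := mul_pos h h'
    _ = _ := by ring

/-- The first instant in `(0, h]` at which an initially positive function vanishes, or `h`. -/
theorem exists_first_zero {f : ℝ → ℝ} (hf : Continuous f) (h0 : ∀ᶠ t in 𝓝[>] 0, 0 < f t)
    {h : ℝ} (hh : 0 < h) :
    ∃ τ, 0 < τ ∧ τ ≤ h ∧ (∀ t ∈ Ioo 0 τ, 0 < f t) ∧ 0 ≤ f τ ∧ (τ = h ∨ f τ = 0) := by
  by_cases hall : ∀ t ∈ Ioc 0 h, 0 < f t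
  · exact ⟨h, hh, le_rfl, fun t ht => hall t ⟨ht.1, ht.2.le⟩,
      (hall h (right_mem_Ioc.2 hh)).le, Or.inl rfl⟩
  push Not at hall
  obtain ⟨t₀, ht₀, hft₀⟩ := hall
  obtain ⟨ε, hε, hεf⟩ := mem_nhdsGT_iff_exists_Ioo_subset.1 h0
  have hε0 : (0 : ℝ) < ε := hε
  -- The search starts at `min ε t₀ > 0`, because `f` may vanish at `0` itself.
  have hZ : IsCompact (Icc (min ε t₀) h ∩ f ⁻¹' Iic 0) :=
    isCompact_Icc.inter_right (isClosed_Iic.preimage hf)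
  obtain ⟨τ, hτ, hleast⟩ := hZ.exists_isLeast ⟨t₀, ⟨min_le_right _ _, ht₀.2⟩, hft₀⟩
  have hτ0 : 0 < τ := (lt_min hε0 ht₀.1).trans_le hτ.1.1
  have hpos : ∀ t ∈ Ioo 0 τ, 0 < f t := by
    intro t ht
    by_contra hcon
    by_cases htε : t < min ε t₀
    · exact hcon (hεf ⟨ht.1, htε.trans_le (min_le_left _ _)⟩)
    · exact absurd (hleast ⟨⟨not_lt.1 htε, ht.2.le.trans hτ.1.2⟩, not_lt.1 hcon⟩) (not_le.2 ht.2)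
  have hnn : 0 ≤ f τ := by
    refine ge_of_tendsto (hf.continuousWithinAt (s := Iio τ) (x := τ)) ?_
    filter_upwards [Ioo_mem_nhdsLT hτ0] with t ht using (hpos t ht).le
  exact ⟨τ, hτ0, hτ.1.2, hpos, hnn, Or.inr (le_antisymm hτ.2 hnn)⟩

theorem eventually_pos_right_of_deriv_pos {f : ℝ → ℝ} {f' a : ℝ} (hd : HasDerivAt f f' a)
    (h0 : 0 ≤ f a) (h : f a = 0 → 0 < f') : ∀ᶠ t in 𝓝[>] a, 0 < f t := by
  rcases h0.eq_or_lt with h0 | h0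
  · have := eventually_nhdsWithin_sign_eq_of_deriv_pos (by rw [hd.deriv]; exact h h0.symm) h0.symm
    filter_upwards [this.filter_mono nhdsWithin_le_nhds, self_mem_nhdsWithin] with t ht hta
    rw [sign_pos (sub_pos.2 hta)] at ht
    exact sign_eq_one_iff.1 ht
  · exact (hd.continuousAt.eventually_const_lt h0).filter_mono nhdsWithin_le_nhds

theorem deriv_nonpos_of_pos_left {f : ℝ → ℝ} {f' a b : ℝ} (hd : HasDerivAt f f' b)
    (h0 : f b = 0) (hab : a < b) (hpos : ∀ t ∈ Ioo a b, 0 < f t) : f' ≤ 0 := by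
  by_contra hcon
  have := eventually_nhdsWithin_sign_eq_of_deriv_pos (by rw [hd.deriv]; exact not_le.1 hcon) h0
  obtain ⟨t, ht, ht'⟩ :=
    ((this.filter_mono nhdsWithin_le_nhds).and (Ioo_mem_nhdsLT hab)).exists
  rw [sign_neg (sub_neg.2 ht'.2), sign_pos (hpos t ht')] at ht
  exact absurd ht (by decide)

/-! ### Steps of the hybrid dynamics with a uniform dwell time -/

namespace System

variable (G : System)

/-- The flow of the affine vector field of mode `k` with rest point `p`. -/
def flow (p : Plane) (k : Mode) (x : Plane) (t : ℝ) : Plane :=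
  p + NormedSpace.exp (t • LinearMap.toContinuousLinearMap (Matrix.toLin' (G.sysMatrix k))) (x - p)

theorem flow_zero (p : Plane) (k : Mode) (x : Plane) : G.flow p k x 0 = x := by
  simp [flow]

theorem hasDerivAt_flow {p : Plane} (hp : G.IsNash p) (k : Mode) (x : Plane) (t : ℝ) :
    HasDerivAt (G.flow p k x) (G.field k (G.flow p k x t)) t := by
  set L := LinearMap.toContinuousLinearMap (Matrix.toLin' (G.sysMatrix k)) with hL
  have h := (hasDerivAt_exp_smul_const' (𝕂 := ℝ) L t).clm_apply (hasDerivAt_const t (x - p))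
  refine (h.const_add p).congr_deriv ?_
  funext i
  have e : G.flow p k x t - p = NormedSpace.exp (t • L) (x - p) := by
    simp [flow, hL]
  rw [hp.field_apply, e]
  have := G.sysMatrix_mulVec k (NormedSpace.exp (t • L) (x - p)) i
  rw [← this, map_zero, add_zero]
  rfl

/-- By linearity the drift is bounded relative to the distance from `p`, so one time span serves all
initial states. This is the source of a dwell time that does not shrink near `p`. -/
theorem eventually_flow_near (p : Plane) {μ : ℝ} (hμ : 0 < μ) :
    ∀ᶠ t in 𝓝 (0 : ℝ), ∀ (k : Mode) (x : Plane), ‖G.flow p k x t - x‖ ≤ μ * ‖x - p‖ := by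
  refine eventually_all.2 fun k => ?_
  set L := LinearMap.toContinuousLinearMap (Matrix.toLin' (G.sysMatrix k)) with hL
  have hc : ContinuousAt (fun t : ℝ => ‖NormedSpace.exp (t • L) - 1‖) 0 :=
    ((hasDerivAt_exp_smul_const' (𝕂 := ℝ) L 0).continuousAt.sub continuousAt_const).norm
  have := hc.eventually_lt_const (by simpa using hμ)
  filter_upwards [this] with t ht x
  have e : G.flow p k x t - x = (NormedSpace.exp (t • L) - 1) (x - p) := by
    simp [flow, hL]; abel
  rw [e]
  exact (ContinuousLinearMap.le_opNorm _ _).trans (by gcongr)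

/-- The rates at `x` fit the mode `k`, and they continue to do so just afterwards. -/
def Entering (k : Mode) (x : Plane) : Prop :=
  ∀ i, 0 ≤ (k i).sgn * G.payoffRate i k x ∧
    (G.payoffRate i k x = 0 → 0 < (k i).sgn * G.rateDeriv i k x)

theorem Entering.of_pos {k : Mode} {x : Plane} (h : ∀ i, 0 < (k i).sgn * G.payoffRate i k x) :
    G.Entering k x :=
  fun i => ⟨(h i).le, fun h0 => by have := h i; simp [h0] at this⟩

theorem payoffRate_sub {p : Plane} (hp : G.IsNash p) {k k' : Mode} (x : Plane) {i j : Fin 2}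
    (hij : i ≠ j) (hj : k' j = k j) :
    G.payoffRate i k' x =
      G.payoffRate i k x + (G.α i (k' i) - G.α i (k i)) * G.marginal i (x - p) ^ 2 := by
  rw [hp.payoffRate_eq k' x hij, hp.payoffRate_eq k x hij, hj]; ring

/-- With `payoffRate_sub`: where the rate of an agent vanishes, flipping its level moves the rate to
the side required by the new level, or leaves it zero. -/
theorem sgn_flip_mul_nonneg (i : Fin 2) (ℓ : Level) :
    0 ≤ ℓ.flip.sgn * (G.α i ℓ.flip - G.α i ℓ) := by
  have := G.αL_le_αH i
  cases ℓ <;> simp [Level.flip, Level.sgn, α] <;> linarith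

/-- Supplies an initial mode. Away from both switching lines the signs of the marginals dictate it;
near the line of agent `i` only the level of `i` is in doubt. -/
theorem eventually_exists_entering {p : Plane} (hp : G.IsNash p) (hG : G.HasComplexEigenvalues)
    (hg : ∀ i j, i ≠ j → G.grad i p j ≠ 0) :
    ∀ᶠ x in 𝓝 p, x ≠ p → ∃ k, G.Entering k x := by
  obtain ⟨κ, hκ, hev⟩ := G.exists_transversal hp hG hg
  refine hev.mono fun x hx hxp => ?_
  have hT := hx hxp
  have hy : 0 < ‖x - p‖ := norm_pos_iff.2 (sub_ne_zero.2 hxp)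
  by_cases hcase : ∃ i j : Fin 2, i ≠ j ∧ |G.marginal j (x - p)| ≤ κ * ‖x - p‖
  · obtain ⟨i, j, hij, hj⟩ := hcase
    have h2 : |G.marginal j (x - p)| ≤ 2 * κ * ‖x - p‖ := hj.trans (by nlinarith)
    have hzi : κ * ‖x - p‖ < |G.marginal i (x - p)| :=
      lt_of_le_of_lt (by nlinarith) ((hT (fun _ => Level.L) i j hij).2 h2).1
    have hz0 : G.marginal i (x - p) ≠ 0 := abs_pos.1 ((by positivity : 0 < κ * ‖x - p‖).trans hzi)
    obtain ⟨m, hm⟩ := Level.exists_sgn_mul_pos (mul_ne_zero (hg j i hij.symm) hz0)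
    set kk : Level → Mode := fun ℓ => Function.update (fun _ => m) i ℓ with hkk
    have hkj : ∀ ℓ, kk ℓ j = m := fun ℓ => by simp [hkk, hij.symm]
    have hki : ∀ ℓ, kk ℓ i = ℓ := fun ℓ => by simp [hkk]
    have hjpos : ∀ ℓ, 0 < (kk ℓ j).sgn * G.payoffRate j (kk ℓ) x := fun ℓ => by
      rw [hkj]
      exact pos_mul_of_pos_mul_of_pos_mul hm ((hT (kk ℓ) j i hij.symm).1 hzi)
    have hent : ∀ ℓ, 0 ≤ ℓ.sgn * G.payoffRate i (kk ℓ) x →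
        (G.payoffRate i (kk ℓ) x = 0 → 0 < ℓ.sgn * G.rateDeriv i (kk ℓ) x) →
        G.Entering (kk ℓ) x := by
      intro ℓ h1 h2 l
      by_cases hl : l = i
      · subst hl; rw [hki]; exact ⟨h1, h2⟩
      · have : l = j := eq_of_ne_of_ne hij hl
        subst this
        exact ⟨(hjpos ℓ).le, fun h0 => by have := hjpos ℓ; simp [h0] at this⟩
    have hdiff := G.payoffRate_sub hp (k := kk Level.L) (k' := kk Level.H) x hij
      (by rw [hkj, hkj])
    rw [hki, hki] at hdiff
    have hmono : G.payoffRate i (kk Level.L) x ≤ G.payoffRate i (kk Level.H) x := by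
      rw [hdiff]
      have : 0 ≤ G.α i Level.H - G.α i Level.L := sub_nonneg.2 (G.αL_le_αH i)
      have := mul_nonneg this (sq_nonneg (G.marginal i (x - p)))
      linarith
    rcases lt_or_ge 0 (G.payoffRate i (kk Level.H) x) with hH | hH
    · exact ⟨_, hent Level.H (by simpa [Level.sgn] using hH.le) fun h0 => absurd h0 hH.ne'⟩
    rcases lt_or_ge (G.payoffRate i (kk Level.L) x) 0 with hL | hL
    · exact ⟨_, hent Level.L (by simpa [Level.sgn] using hL.le) fun h0 => absurd h0 hL.ne⟩
    -- The rate at H is at least the rate at L, so if neither level fits strictly, both rates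
    -- vanish. The derivative, whose sign is the same for both levels, then decides.
    have hz : ∀ ℓ, G.payoffRate i (kk ℓ) x = 0 := by
      intro ℓ; cases ℓ <;> linarith
    obtain ⟨ℓ, hℓ⟩ := Level.exists_sgn_mul_pos
      (mul_ne_zero (mul_ne_zero (hg i j hij) (G.coupling_ne hG hij)) hz0)
    exact ⟨_, hent ℓ (by simp [hz]) fun _ =>
      pos_mul_of_pos_mul_of_pos_mul hℓ ((hT (kk ℓ) i j hij).2 h2).2⟩
  · push Not at hcase
    have h1 : ∀ i, ∃ ℓ : Level, ∀ j, i ≠ j → 0 < ℓ.sgn * (G.grad i p j * G.marginal j (x - p)) := by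
      intro i
      obtain ⟨j, hij⟩ := exists_other i
      have hz0 : G.marginal j (x - p) ≠ 0 :=
        abs_pos.1 ((by positivity : 0 < κ * ‖x - p‖).trans (hcase i j hij))
      obtain ⟨ℓ, hℓ⟩ := Level.exists_sgn_mul_pos (mul_ne_zero (hg i j hij) hz0)
      refine ⟨ℓ, fun l hl => ?_⟩
      have : l = j := eq_of_ne_of_ne hij hl.symm
      rwa [this]
    choose k hk using h1
    refine ⟨k, Entering.of_pos G fun i => ?_⟩
    obtain ⟨j, hij⟩ := exists_other i
    exact pos_mul_of_pos_mul_of_pos_mul (hk i j hij) ((hT k i j hij).1 (hcase i j hij))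

/-- One step of the hybrid dynamics: near `p`, an entering mode can be followed up to a switching
instant or for the time `h`, the mode after the step is entering again, and a step that follows a
genuine switch lasts `h`. -/
theorem exists_step {p : Plane} (hp : G.IsNash p) (hG : G.HasComplexEigenvalues)
    (hg : ∀ i j, i ≠ j → G.grad i p j ≠ 0) :
    ∃ r > 0, ∃ h > 0, ∃ Fresh : Mode → Plane → Prop, ∀ (k : Mode) (x : Plane), x ≠ p →
      dist x p < r → G.Entering k x → ∃ τ k', 0 < τ ∧ τ ≤ h ∧
        (∀ t ∈ Ioo 0 τ, ∀ i, 0 < (k i).sgn * G.payoffRate i k (G.flow p k x t)) ∧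
        (∀ i, 0 ≤ (k i).sgn * G.payoffRate i k (G.flow p k x τ)) ∧
        (∀ i, (G.payoffRate i k (G.flow p k x τ) = 0 → k' i = (k i).flip) ∧
          (G.payoffRate i k (G.flow p k x τ) ≠ 0 → k' i = k i)) ∧
        G.flow p k x τ ≠ p ∧ G.Entering k' (G.flow p k x τ) ∧
        (τ = h ∨ Fresh k' (G.flow p k x τ)) ∧ (Fresh k x → τ = h) := by
  obtain ⟨κ, hκ, hev⟩ := G.exists_transversal hp hG hg
  obtain ⟨r, hr, hT⟩ := Metric.eventually_nhds_iff.1 hev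
  obtain ⟨C, hC0, hC⟩ : ∃ C > 0, ∀ i v, |G.marginal i v| ≤ C * ‖v‖ := by
    refine ⟨1 + ∑ i, (|G.A i i 0| + |G.A i i 1|), by positivity, fun i v => ?_⟩
    have h0 := norm_le_pi_norm v 0
    have h1 := norm_le_pi_norm v 1
    rw [Real.norm_eq_abs] at h0 h1
    have h2 : |G.A i i 0| + |G.A i i 1| ≤ ∑ i, (|G.A i i 0| + |G.A i i 1|) :=
      Finset.single_le_sum (f := fun i => |G.A i i 0| + |G.A i i 1|)
        (fun _ _ => by positivity) (Finset.mem_univ i)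
    calc |G.marginal i v| ≤ |G.A i i 0| * |v 0| + |G.A i i 1| * |v 1| := by
          rw [← abs_mul, ← abs_mul]; exact abs_add_le _ _
      _ ≤ |G.A i i 0| * ‖v‖ + |G.A i i 1| * ‖v‖ := by gcongr
      _ = (|G.A i i 0| + |G.A i i 1|) * ‖v‖ := by ring
      _ ≤ _ := mul_le_mul_of_nonneg_right (by linarith) (norm_nonneg v)
  -- Chosen so that a drift of relative size `μ` cannot leave the `2 * κ` cone from the `κ` cone:
  -- the marginal changes by at most `C * μ * ‖x - p‖`, and the norm shrinks at most by the factor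
  -- `1 - μ`.
  obtain ⟨μ, hμ, hμC, hμ1⟩ : ∃ μ > 0, C * μ + 2 * κ * μ ≤ κ ∧ μ ≤ 1 / 2 := by
    refine ⟨κ / (C + 2 * κ), by positivity, le_of_eq (by field_simp), ?_⟩
    rw [div_le_div_iff₀ (by positivity) (by positivity)]
    linarith
  obtain ⟨h', hh', hnear⟩ := Metric.eventually_nhds_iff.1 (G.eventually_flow_near p hμ)
  set h := h' / 2 with hh
  have hpos : 0 < h := by positivity
  -- `Fresh` describes a state just after a switch of `i`: it lies in the `κ` cone of the switching
  -- line of `i`, the rate of `i` moves away from zero in the direction of its level, and the rate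
  -- of `j` has the sign of its level.
  refine ⟨r / 2, by positivity, h, hpos, fun k x => ∃ i j : Fin 2, i ≠ j ∧
    |G.marginal j (x - p)| ≤ κ * ‖x - p‖ ∧
    0 < (k i).sgn * (G.grad i p j * G.A j j i * G.marginal i (x - p)) ∧
    0 < (k j).sgn * (G.grad j p i * G.marginal i (x - p)), fun k x hxp hxr hent => ?_⟩
  have hy : 0 < ‖x - p‖ := norm_pos_iff.2 (sub_ne_zero.2 hxp)
  have hfl : ∀ t ∈ Icc 0 h, ‖G.flow p k x t - x‖ ≤ μ * ‖x - p‖ := fun t ht =>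
    hnear (by rw [Real.dist_eq, sub_zero, abs_of_nonneg ht.1]; linarith [ht.2]) k x
  have hlow : ∀ t ∈ Icc 0 h, (1 - μ) * ‖x - p‖ ≤ ‖G.flow p k x t - p‖ := fun t ht => by
    have h1 := hfl t ht
    have h2 := norm_sub_norm_le (x - p) (x - G.flow p k x t)
    rw [norm_sub_rev x (G.flow p k x t)] at h2
    have e : x - p - (x - G.flow p k x t) = G.flow p k x t - p := by abel
    rw [e] at h2
    linarith
  have hne : ∀ t ∈ Icc 0 h, G.flow p k x t ≠ p := fun t ht h0 => by
    have := hlow t ht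
    rw [h0, sub_self, norm_zero] at this
    have : 0 < (1 - μ) * ‖x - p‖ := mul_pos (by linarith) hy
    linarith
  have hin : ∀ t ∈ Icc 0 h, dist (G.flow p k x t) p < r := fun t ht => by
    have h1 := hfl t ht
    have h2 := norm_add_le (G.flow p k x t - x) (x - p)
    rw [sub_add_sub_cancel] at h2
    rw [dist_eq_norm] at hxr ⊢
    nlinarith
  have hTt : ∀ t ∈ Icc 0 h, _ := fun t ht => hT (hin t ht) (hne t ht)
  set X := G.flow p k x with hX
  have hX0 : X 0 = x := G.flow_zero p k x
  have hXd := G.hasDerivAt_flow hp k x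
  have hR : ∀ i t, HasDerivAt (fun u => (k i).sgn * G.payoffRate i k (X u))
      ((k i).sgn * G.rateDeriv i k (X t)) t := fun i t =>
    (G.hasDerivAt_payoffRate_comp (hXd t) i).const_mul _
  have hRc : ∀ i, Continuous fun u => (k i).sgn * G.payoffRate i k (X u) := fun i =>
    continuous_iff_continuousAt.2 fun t => (hR i t).continuousAt
  have hstart : ∀ i, ∀ᶠ t in 𝓝[>] (0 : ℝ), 0 < (k i).sgn * G.payoffRate i k (X t) := fun i => by
    refine eventually_pos_right_of_deriv_pos (hR i 0) ?_ fun h0 => ?_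
    · simpa only [hX0] using (hent i).1
    · rw [hX0] at h0 ⊢
      have hs : (k i).sgn ≠ 0 := by rcases (k i).sgn_eq with h | h <;> rw [h] <;> norm_num
      exact (hent i).2 ((mul_eq_zero.1 h0).resolve_left hs)
  obtain ⟨τ, hτ0, hτh, hτpos, hτnn, hτor⟩ := exists_first_zero ((hRc 0).min (hRc 1))
    ((hstart 0).and (hstart 1) |>.mono fun t ht => lt_min ht.1 ht.2) hpos
  have hτI : τ ∈ Icc 0 h := ⟨hτ0.le, hτh⟩
  have hpos' : ∀ t ∈ Ioo 0 τ, ∀ i, 0 < (k i).sgn * G.payoffRate i k (X t) := fun t ht i => by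
    have := lt_min_iff.1 (hτpos t ht)
    fin_cases i
    · exact this.1
    · exact this.2
  have hnn' : ∀ i, 0 ≤ (k i).sgn * G.payoffRate i k (X τ) := fun i => by
    have := le_min_iff.1 hτnn
    fin_cases i
    · exact this.1
    · exact this.2
  have hor' : τ = h ∨ ∃ i, G.payoffRate i k (X τ) = 0 := by
    refine hτor.imp_right fun h0 => ?_
    have hs : ∀ i, (k i).sgn ≠ 0 := fun i => by
      rcases (k i).sgn_eq with h | h <;> rw [h] <;> norm_num
    rcases min_choice ((k 0).sgn * G.payoffRate 0 k (X τ)) ((k 1).sgn * G.payoffRate 1 k (X τ))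
      with e | e <;> rw [e] at h0
    · exact ⟨0, (mul_eq_zero.1 h0).resolve_left (hs 0)⟩
    · exact ⟨1, (mul_eq_zero.1 h0).resolve_left (hs 1)⟩
  classical
  set k' : Mode := fun i => if G.payoffRate i k (X τ) = 0 then (k i).flip else k i with hk'
  refine ⟨τ, k', hτ0, hτh, hpos', hnn', fun i => ⟨fun h0 => if_pos h0, fun h0 => if_neg h0⟩,
    hne τ hτI, ?_⟩
  have hY : 0 < ‖X τ - p‖ := norm_pos_iff.2 (sub_ne_zero.2 (hne τ hτI))
  have hafter : G.Entering k' (X τ) ∧ (τ = h ∨ ∃ i j : Fin 2, i ≠ j ∧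
      |G.marginal j (X τ - p)| ≤ κ * ‖X τ - p‖ ∧
      0 < (k' i).sgn * (G.grad i p j * G.A j j i * G.marginal i (X τ - p)) ∧
      0 < (k' j).sgn * (G.grad j p i * G.marginal i (X τ - p))) := by
    by_cases hz : ∃ i, G.payoffRate i k (X τ) = 0
    · obtain ⟨i, hi⟩ := hz
      obtain ⟨j, hij⟩ := exists_other i
      have hzj : |G.marginal j (X τ - p)| ≤ κ * ‖X τ - p‖ := by
        by_contra hcon
        have := (hTt τ hτI k i j hij).1 (not_le.1 hcon)
        simp [hi] at this
      have hzj2 : |G.marginal j (X τ - p)| ≤ 2 * κ * ‖X τ - p‖ := hzj.trans (by nlinarith)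
      have htr := fun q : Mode => (hTt τ hτI q i j hij).2 hzj2
      have hzi : κ * ‖X τ - p‖ < |G.marginal i (X τ - p)| :=
        lt_of_le_of_lt (by nlinarith) (htr k).1
      have hRj := fun q : Mode => (hTt τ hτI q j i hij.symm).1 hzi
      have hRj0 : G.payoffRate j k (X τ) ≠ 0 := fun h0 => by
        have := hRj k
        simp [h0] at this
      have hki : k' i = (k i).flip := if_pos hi
      have hkj : k' j = k j := if_neg hRj0
      have hsj : 0 < (k' j).sgn * (G.grad j p i * G.marginal i (X τ - p)) := by
        rw [hkj]
        refine pos_mul_of_pos_mul_of_pos_mul (b := G.payoffRate j k (X τ)) ?_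
          (by rw [mul_comm]; exact hRj k)
        refine lt_of_le_of_ne (hnn' j) (Ne.symm (mul_ne_zero ?_ hRj0))
        rcases (k j).sgn_eq with h | h <;> rw [h] <;> norm_num
      have hsi : 0 < (k' i).sgn * (G.grad i p j * G.A j j i * G.marginal i (X τ - p)) := by
        -- The rate reached zero from the side of the old level, so its derivative points to the
        -- other side, strictly by transversality. As this direction does not depend on the mode,
        -- the flipped level is entering.
        have hSle := deriv_nonpos_of_pos_left (hR i τ) (by rw [hi, mul_zero]) hτ0
          fun t ht => hpos' t ht i
        have hS := (htr k).2
        have hS0 : G.rateDeriv i k (X τ) ≠ 0 := fun h0 => by simp [h0] at hS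
        rw [hki, Level.sgn_flip]
        refine pos_mul_of_pos_mul_of_pos_mul (b := G.rateDeriv i k (X τ)) ?_
          (by rw [mul_comm]; exact hS)
        rw [neg_mul, neg_pos]
        refine lt_of_le_of_ne hSle (mul_ne_zero ?_ hS0)
        rcases (k i).sgn_eq with h | h <;> rw [h] <;> norm_num
      refine ⟨fun l => ?_, Or.inr ⟨i, j, hij, hzj, hsi, hsj⟩⟩
      by_cases hl : l = i
      · rw [hl]
        refine ⟨?_, fun _ => pos_mul_of_pos_mul_of_pos_mul hsi (htr k').2⟩
        rw [G.payoffRate_sub hp (X τ) hij hkj, hi, zero_add, ← mul_assoc, hki]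
        exact mul_nonneg (G.sgn_flip_mul_nonneg i (k i)) (sq_nonneg _)
      · have hlj : l = j := eq_of_ne_of_ne hij hl
        rw [hlj]
        have := pos_mul_of_pos_mul_of_pos_mul hsj (hRj k')
        exact ⟨this.le, fun h0 => by simp [h0] at this⟩
    · have hkk : k' = k := by
        push Not at hz
        funext i
        exact if_neg (hz i)
      rw [hkk]
      refine ⟨fun i => ⟨hnn' i, fun h0 => absurd ⟨i, h0⟩ hz⟩, Or.inl (hor'.resolve_right hz)⟩
  refine ⟨hafter.1, hafter.2, ?_⟩
  rintro ⟨i, j, hij, hzj, hsi, hsj⟩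
  refine hor'.resolve_right ?_
  have hmX : ∀ l, ∀ t ∈ Icc 0 h,
      |G.marginal l (X t - p) - G.marginal l (x - p)| ≤ C * (μ * ‖x - p‖) := fun l t ht => by
    have e : G.marginal l (X t - p) - G.marginal l (x - p) = G.marginal l (X t - x) := by
      simp only [marginal, Pi.sub_apply]; ring
    rw [e]
    exact (hC l _).trans (mul_le_mul_of_nonneg_left (hfl t ht) hC0.le)
  have hj2 : ∀ t ∈ Icc 0 h, |G.marginal j (X t - p)| ≤ 2 * κ * ‖X t - p‖ := fun t ht => by
    have h1 := hmX j t ht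
    have h2 := abs_sub_abs_le_abs_sub (G.marginal j (X t - p)) (G.marginal j (x - p))
    have h3 := mul_le_mul_of_nonneg_left (hlow t ht) (by positivity : 0 ≤ 2 * κ)
    have h4 := mul_le_mul_of_nonneg_right hμC hy.le
    linarith
  have hi2 : ∀ t ∈ Icc 0 h, 2 * κ * ‖X t - p‖ < |G.marginal i (X t - p)| := fun t ht =>
    ((hTt t ht k i j hij).2 (hj2 t ht)).1
  have hisign : ∀ t ∈ Icc 0 h, 0 < G.marginal i (x - p) * G.marginal i (X t - p) := fun t ht => by
    have h1 := abs_le.1 (hmX i t ht)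
    have h0 := hi2 0 ⟨le_rfl, hpos.le⟩
    rw [hX0] at h0
    have h4 := mul_le_mul_of_nonneg_right hμC hy.le
    have h5 : 0 < κ * ‖x - p‖ := by positivity
    have h6 : 0 < κ * μ * ‖x - p‖ := by positivity
    rcases lt_abs.1 h0 with h | h
    · exact mul_pos (by linarith) (by linarith [h1.1])
    · exact mul_pos_of_neg_of_neg (by linarith) (by linarith [h1.2])
  have transfer : ∀ a b : ℝ, ∀ t ∈ Icc 0 h, 0 < a * (b * G.marginal i (x - p)) →
      0 < a * (b * G.marginal i (X t - p)) := fun a b t ht h0 => by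
    have := pos_mul_of_pos_mul_of_pos_mul (a := a * b) (by linarith) (hisign t ht)
    linarith
  have hjpos : ∀ t ∈ Icc 0 h, 0 < (k j).sgn * G.payoffRate j k (X t) := fun t ht => by
    have hY : 0 < ‖X t - p‖ := norm_pos_iff.2 (sub_ne_zero.2 (hne t ht))
    exact pos_mul_of_pos_mul_of_pos_mul (transfer _ _ t ht hsj)
      ((hTt t ht k j i hij.symm).1 (lt_of_le_of_lt (by nlinarith) (hi2 t ht)))
  have hipos : 0 < (k i).sgn * G.payoffRate i k (X τ) := by
    -- The flow stays in the `2 * κ` cone and the marginal of `i` keeps its sign, so the derivative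
    -- keeps the sign recorded in `Fresh` and the rate cannot return to zero.
    have hmono : StrictMonoOn (fun u => (k i).sgn * G.payoffRate i k (X u)) (Icc 0 h) := by
      refine strictMonoOn_of_deriv_pos (convex_Icc 0 h) (hRc i).continuousOn fun t ht => ?_
      rw [(hR i t).deriv]
      have ht' : t ∈ Icc 0 h := interior_subset ht
      exact pos_mul_of_pos_mul_of_pos_mul (transfer _ _ t ht' hsi)
        ((hTt t ht' k i j hij).2 (hj2 t ht')).2
    have h1 := hmono ⟨le_rfl, hpos.le⟩ hτI hτ0
    have h2 := (hent i).1
    simp only [hX0] at h1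
    exact h2.trans_lt h1
  rintro ⟨l, hl⟩
  by_cases hli : l = i
  · rw [hli] at hl
    simp [hl] at hipos
  · have hlj : l = j := eq_of_ne_of_ne hij hli
    rw [hlj] at hl
    have := hjpos τ hτI
    simp [hl] at this

end System

/-! ### Concatenation of steps into global trajectories -/

theorem exists_mem_Ioc_of_sequence {t : ℕ → ℝ} {N : ℕ} {u : ℝ} (h0 : t 0 < u) (hN : u ≤ t N) :
    ∃ n < N, u ∈ Ioc (t n) (t (n + 1)) := by
  induction N with
  | zero => exact absurd hN (not_le.2 h0)
  | succ N ih =>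
    rcases le_or_gt u (t N) with h | h
    · obtain ⟨n, hn, hu⟩ := ih h
      exact ⟨n, hn.trans (Nat.lt_succ_self N), hu⟩
    · exact ⟨N, Nat.lt_succ_self N, h, hN⟩

theorem exists_mem_Ico_of_sequence {t : ℕ → ℝ} {N : ℕ} {u : ℝ} (h0 : t 0 ≤ u) (hN : u < t N) :
    ∃ n < N, u ∈ Ico (t n) (t (n + 1)) := by
  induction N with
  | zero => exact absurd hN (not_lt.2 h0)
  | succ N ih =>
    rcases lt_or_ge u (t N) with h | h
    · obtain ⟨n, hn, hu⟩ := ih h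
      exact ⟨n, hn.trans (Nat.lt_succ_self N), hu⟩
    · exact ⟨N, Nat.lt_succ_self N, h, hN⟩

namespace System

variable (G : System)

/-- Consecutive mode phases that respect the switching rule form a trajectory. -/
theorem isTrajectoryOn_of_pieces {N : ℕ} {t : ℕ → ℝ} {k : ℕ → Mode} {φ : ℕ → ℝ → Plane}
    {x : ℝ → Plane} {s : ℝ → Mode} {T : ℝ} (ht0 : t 0 = 0) (ht : StrictMono t) (hT : T ≤ t N)
    (hx : ∀ n < N, ∀ u ∈ Icc (t n) (t (n + 1)), x u = φ n u)
    (hs : ∀ n, ∀ u ∈ Ico (t n) (t (n + 1)), s u = k n)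
    (hφ : ∀ n, ∀ u, HasDerivAt (φ n) (G.field (k n) (φ n u)) u)
    (hpos : ∀ n < N, ∀ u ∈ Ioo (t n) (t (n + 1)), ∀ i,
      0 < (k n i).sgn * G.payoffRate i (k n) (φ n u))
    (hnonneg : ∀ n < N, ∀ i, 0 ≤ (k n i).sgn * G.payoffRate i (k n) (φ n (t (n + 1))))
    (hswitch : ∀ n < N, ∀ i,
      (G.payoffRate i (k n) (φ n (t (n + 1))) = 0 → k (n + 1) i = (k n i).flip) ∧
      (G.payoffRate i (k n) (φ n (t (n + 1))) ≠ 0 → k (n + 1) i = k n i)) :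
    G.IsTrajectoryOn T x s := by
  have hlt : ∀ n, t n < t (n + 1) := fun n => ht (Nat.lt_succ_self n)
  have left : ∀ u ∈ Ioc 0 T, ∃ n < N, u ∈ Ioc (t n) (t (n + 1)) := fun u hu =>
    exists_mem_Ioc_of_sequence (ht0 ▸ hu.1) (hu.2.trans hT)
  have right : ∀ u ∈ Ico 0 T, ∃ n < N, u ∈ Ico (t n) (t (n + 1)) := fun u hu =>
    exists_mem_Ico_of_sequence (ht0 ▸ hu.1) (hu.2.trans_le hT)
  have hφc : ∀ n, Continuous (φ n) := fun n =>
    continuous_iff_continuousAt.2 fun u => (hφ n u).continuousAt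
  have inside : ∀ u ∈ Icc 0 T, u ∉ (Finset.range (N + 1)).image t →
      ∃ n < N, u ∈ Ioo (t n) (t (n + 1)) := by
    intro u hu hF
    have hne : ∀ n ≤ N, u ≠ t n := fun n hn h => hF
      (Finset.mem_image.2 ⟨n, Finset.mem_range.2 (Nat.lt_succ_of_le hn), h.symm⟩)
    have h0 : u ≠ 0 := ht0 ▸ hne 0 (Nat.zero_le N)
    obtain ⟨n, hn, h⟩ := left u ⟨lt_of_le_of_ne hu.1 h0.symm, hu.2⟩
    exact ⟨n, hn, h.1, lt_of_le_of_ne h.2 (hne (n + 1) hn)⟩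
  have hderiv : ∀ i, ∀ n < N, ∀ u ∈ Ioc (t n) (t (n + 1)),
      derivWithin (fun v => G.payoff i (x v)) (Iic u) u = G.payoffRate i (k n) (φ n u) := by
    intro i n hn u hu
    have h := (G.hasDerivAt_payoff_comp (hφ n u) i).hasDerivWithinAt (s := Iic u)
    refine (h.congr_of_eventuallyEq ?_ ?_).derivWithin (uniqueDiffWithinAt_Iic u)
    · filter_upwards [Ioc_mem_nhdsLE hu.1] with v hv
      rw [hx n hn v ⟨hv.1.le, hv.2.trans hu.2⟩]
    · simp only [hx n hn u ⟨hu.1.le, hu.2⟩]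
  have hend : ∀ n, s (t (n + 1)) = k (n + 1) := fun n => hs (n + 1) _ ⟨le_rfl, hlt (n + 1)⟩
  have hsign : ∀ i, ∀ n < N, ∀ u ∈ Ioc (t n) (t (n + 1)),
      0 ≤ (k n i).sgn * G.payoffRate i (k n) (φ n u) ∧
      (G.payoffRate i (k n) (φ n u) ≠ 0 → s u i = k n i) := by
    intro i n hn u hu
    rcases hu.2.eq_or_lt with h | h
    · rw [h, hend]
      exact ⟨hnonneg n hn i, (hswitch n hn i).2⟩
    · exact ⟨(hpos n hn u ⟨hu.1, h⟩ i).le, fun _ => by rw [hs n u ⟨hu.1.le, h⟩]⟩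
  refine ⟨fun u hu => ?_, ⟨(Finset.range (N + 1)).image t, fun u hu hF => ?_, fun u hu hF => ?_⟩,
    fun i u hu h => ?_, fun i u hu h => ?_, fun i u hu h _ => ?_, fun u hu _ => ?_⟩
  · have hL : ContinuousWithinAt x (Icc 0 T ∩ Iic u) u := by
      rcases hu.1.eq_or_lt with h | h
      · refine continuousWithinAt_singleton.mono fun v hv => ?_
        exact le_antisymm hv.2 (h ▸ hv.1.1)
      · obtain ⟨n, hn, hun⟩ := left u ⟨h, hu.2⟩
        refine ((hφc n).continuousWithinAt (s := Iic u)).congr_of_eventuallyEq ?_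
          (hx n hn u ⟨hun.1.le, hun.2⟩) |>.mono inter_subset_right
        filter_upwards [Ioc_mem_nhdsLE hun.1] with v hv
        exact hx n hn v ⟨hv.1.le, hv.2.trans hun.2⟩
    have hR : ContinuousWithinAt x (Icc 0 T ∩ Ici u) u := by
      rcases hu.2.eq_or_lt with h | h
      · refine continuousWithinAt_singleton.mono fun v hv => ?_
        exact le_antisymm (h ▸ hv.1.2) hv.2
      · obtain ⟨n, hn, hun⟩ := right u ⟨hu.1, h⟩
        refine ((hφc n).continuousWithinAt (s := Ici u)).congr_of_eventuallyEq ?_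
          (hx n hn u ⟨hun.1, hun.2.le⟩) |>.mono inter_subset_right
        filter_upwards [Ico_mem_nhdsGE hun.2] with v hv
        exact hx n hn v ⟨hun.1.trans hv.1, hv.2.le⟩
    refine (hL.union hR).mono fun v hv => ?_
    rcases le_total v u with h | h
    · exact Or.inl ⟨hv, h⟩
    · exact Or.inr ⟨hv, h⟩
  · obtain ⟨n, hn, hun⟩ := inside u hu hF
    refine Filter.Eventually.filter_mono nhdsWithin_le_nhds ?_
    filter_upwards [Ioo_mem_nhds hun.1 hun.2] with v hv
    rw [hs n v ⟨hv.1.le, hv.2⟩, hs n u ⟨hun.1.le, hun.2⟩]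
  · obtain ⟨n, hn, hun⟩ := inside u (Ioo_subset_Icc_self hu) hF
    rw [hs n u ⟨hun.1.le, hun.2⟩, hx n hn u (Ioo_subset_Icc_self hun)]
    refine (hφ n u).congr_of_eventuallyEq ?_
    filter_upwards [Ioo_mem_nhds hun.1 hun.2] with v hv
    exact hx n hn v (Ioo_subset_Icc_self hv)
  · obtain ⟨n, hn, hun⟩ := left u hu
    rw [hderiv i n hn u hun] at h
    obtain ⟨h1, h2⟩ := hsign i n hn u hun
    rw [h2 h.ne]
    rcases hk : k n i with _ | _
    · rfl
    · rw [hk] at h1; simp only [Level.sgn, one_mul] at h1; exact absurd h (not_lt.2 h1)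
  · obtain ⟨n, hn, hun⟩ := left u hu
    rw [hderiv i n hn u hun] at h
    obtain ⟨h1, h2⟩ := hsign i n hn u hun
    rw [h2 h.ne']
    rcases hk : k n i with _ | _
    · rw [hk] at h1; simp only [Level.sgn] at h1; linarith
    · rfl
  · obtain ⟨n, hn, hun⟩ := left u hu
    rw [hderiv i n hn u hun] at h
    -- Inside a piece no rate vanishes, so an observed zero can only sit at its right end, where `s`
    -- already takes the next mode.
    have hu' : u = t (n + 1) := by
      by_contra hne
      have := hpos n hn u ⟨hun.1, lt_of_le_of_ne hun.2 hne⟩ i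
      simp [h] at this
    filter_upwards [Ioo_mem_nhdsLT hun.1] with v hv
    rw [hs n v ⟨hv.1.le, hv.2.trans_le hun.2⟩, hu', hend,
      (hswitch n hn i).1 (hu' ▸ h)]
    exact (k n i).flip_ne
  · obtain ⟨n, hn, hun⟩ := right u hu
    filter_upwards [Ioo_mem_nhdsGT hun.2] with v hv
    rw [hs n v ⟨hun.1.trans hv.1.le, hv.2⟩, hs n u hun]

theorem isTrajectory_const {p : Plane} (hp : G.IsNash p) :
    G.IsTrajectory (fun _ => p) (fun _ => default) := by
  intro T _
  refine ⟨continuousOn_const, ⟨∅, fun t _ _ => by simp, fun t _ _ => ?_⟩, fun i t _ h => ?_,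
    fun i t _ h => ?_, fun i t _ _ h => absurd hp h, fun t _ _ => by simp⟩
  · rw [hp.field_self]; exact hasDerivAt_const t p
  · simp at h
  · simp at h

/-- If the Nash equilibrium is stable, global trajectories start at all nearby states. -/
theorem IsStable.exists_isTrajectory {G : System} {p : Plane} (hst : G.IsStable p)
    (hp : G.IsNash p) (hG : G.HasComplexEigenvalues)
    (hg : ∀ i j, i ≠ j → G.grad i p j ≠ 0) :
    ∃ δ > 0, ∀ x₀, dist x₀ p < δ → ∃ x s, G.IsTrajectory x s ∧ x 0 = x₀ := by
  obtain ⟨r, hr, h, hh, Fresh, hstep⟩ := G.exists_step hp hG hg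
  obtain ⟨δ₁, hδ₁, hent⟩ := Metric.eventually_nhds_iff.1 (G.eventually_exists_entering hp hG hg)
  obtain ⟨δ₂, hδ₂, hstay⟩ := hst r hr
  refine ⟨min r (min δ₁ δ₂), by positivity, fun x₀ hx₀ => ?_⟩
  obtain ⟨hxr, hx12⟩ := lt_min_iff.1 hx₀
  obtain ⟨hx1, hx2⟩ := lt_min_iff.1 hx12
  by_cases hx₀p : x₀ = p
  · exact ⟨_, _, G.isTrajectory_const hp, hx₀p.symm⟩
  obtain ⟨k₀, hk₀⟩ := hent hx1 hx₀p
  have hstep' : ∀ q : Mode × Plane, ∃ τ : ℝ, ∃ k' : Mode, 0 < τ ∧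
      (q.2 ≠ p → dist q.2 p < r → G.Entering q.1 q.2 →
        (∀ t ∈ Ioo 0 τ, ∀ i, 0 < (q.1 i).sgn * G.payoffRate i q.1 (G.flow p q.1 q.2 t)) ∧
        (∀ i, 0 ≤ (q.1 i).sgn * G.payoffRate i q.1 (G.flow p q.1 q.2 τ)) ∧
        (∀ i, (G.payoffRate i q.1 (G.flow p q.1 q.2 τ) = 0 → k' i = (q.1 i).flip) ∧
          (G.payoffRate i q.1 (G.flow p q.1 q.2 τ) ≠ 0 → k' i = q.1 i)) ∧
        G.flow p q.1 q.2 τ ≠ p ∧ G.Entering k' (G.flow p q.1 q.2 τ) ∧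
        (τ = h ∨ Fresh k' (G.flow p q.1 q.2 τ)) ∧ (Fresh q.1 q.2 → τ = h)) := by
    intro q
    by_cases hq : q.2 ≠ p ∧ dist q.2 p < r ∧ G.Entering q.1 q.2
    · obtain ⟨τ, k', h1, -, h2⟩ := hstep q.1 q.2 hq.1 hq.2.1 hq.2.2
      exact ⟨τ, k', h1, fun _ _ _ => h2⟩
    -- Junk value off the good states. The duration must be positive there too, so that `t` is
    -- strictly increasing before all states are known to be good.
    · exact ⟨1, q.1, one_pos, fun a b c => absurd ⟨a, b, c⟩ hq⟩
  choose τ nk hτ hq using hstep'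
  set Q : ℕ → Mode × Plane := fun n =>
    Nat.rec (k₀, x₀) (fun _ q => (nk q, G.flow p q.1 q.2 (τ q))) n with hQ
  have hQ0 : Q 0 = (k₀, x₀) := rfl
  have hQs : ∀ n, Q (n + 1) = (nk (Q n), G.flow p (Q n).1 (Q n).2 (τ (Q n))) := fun n => rfl
  set t : ℕ → ℝ := fun n => ∑ m ∈ Finset.range n, τ (Q m) with htdef
  have ht0 : t 0 = 0 := by simp [htdef]
  have hts : ∀ n, t (n + 1) = t n + τ (Q n) := fun n => Finset.sum_range_succ _ _
  have ht : StrictMono t := strictMono_nat_of_lt_succ fun n => by rw [hts]; linarith [hτ (Q n)]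
  set φ : ℕ → ℝ → Plane := fun n u => G.flow p (Q n).1 (Q n).2 (u - t n) with hφdef
  have hφt : ∀ n, φ n (t n) = (Q n).2 := fun n => by simp [hφdef, flow_zero]
  have hφs : ∀ n, φ n (t (n + 1)) = (Q (n + 1)).2 := fun n => by simp [hφdef, hts, hQs]
  set idx : ℝ → ℕ := fun u => sInf {n | u < t (n + 1)} with hidx
  have hidxn : ∀ n, ∀ u ∈ Ico (t n) (t (n + 1)), idx u = n := by
    intro n u hu
    refine le_antisymm (Nat.sInf_le hu.2) (le_csInf ⟨n, hu.2⟩ fun m hm => ?_)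
    have : t n < t (m + 1) := hu.1.trans_lt hm
    exact Nat.lt_succ_iff.1 (ht.lt_iff_lt.1 this)
  set x : ℝ → Plane := fun u => φ (idx u) u with hxdef
  set s : ℝ → Mode := fun u => (Q (idx u)).1 with hsdef
  have hx : ∀ n, ∀ u ∈ Icc (t n) (t (n + 1)), x u = φ n u := by
    intro n u hu
    rcases hu.2.eq_or_lt with h | h
    · have : idx u = n + 1 := hidxn (n + 1) u ⟨h.ge, by rw [h]; exact ht (Nat.lt_succ_self _)⟩
      simp only [hxdef, this]
      rw [h]
      exact (hφt (n + 1)).trans (hφs n).symm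
    · simp only [hxdef, hidxn n u ⟨hu.1, h⟩]
  have hs : ∀ n, ∀ u ∈ Ico (t n) (t (n + 1)), s u = (Q n).1 := fun n u hu => by
    simp only [hsdef, hidxn n u hu]
  have hφd : ∀ n, ∀ u, HasDerivAt (φ n) (G.field (Q n).1 (φ n u)) u := fun n u =>
    (G.hasDerivAt_flow hp (Q n).1 (Q n).2 (u - t n)).comp_sub_const u (t n)
  have hx0 : x 0 = x₀ := by
    rw [hx 0 0 ⟨ht0.le, by rw [← ht0]; exact (ht (Nat.lt_succ_self 0)).le⟩, ← ht0, hφt]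
    rfl
  have htraj : ∀ N, (∀ n < N, (Q n).2 ≠ p ∧ dist (Q n).2 p < r ∧ G.Entering (Q n).1 (Q n).2) →
      ∀ T ≤ t N, G.IsTrajectoryOn T x s := by
    intro N hgood T hT
    refine G.isTrajectoryOn_of_pieces (k := fun n => (Q n).1) ht0 ht hT (fun n _ => hx n) hs hφd
      (fun n hn u hu => ?_) (fun n hn => ?_) (fun n hn => ?_)
    · obtain ⟨a, b, c⟩ := hgood n hn
      exact (hq (Q n) a b c).1 (u - t n) ⟨by linarith [hu.1], by linarith [hu.2, hts n]⟩
    · obtain ⟨a, b, c⟩ := hgood n hn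
      have := (hq (Q n) a b c).2.1
      rw [hφs, hQs]
      exact this
    · obtain ⟨a, b, c⟩ := hgood n hn
      have := (hq (Q n) a b c).2.2.1
      rw [hφs, hQs]
      exact this
  -- Strong induction: the pieces built so far form a trajectory on a finite interval, and stability
  -- keeps its endpoint in the ball where the next step is available.
  have hgood : ∀ n, (Q n).2 ≠ p ∧ dist (Q n).2 p < r ∧ G.Entering (Q n).1 (Q n).2 := by
    intro n
    induction n using Nat.strong_induction_on with
    | _ n ih =>
      cases n with
      | zero => exact ⟨hx₀p, hxr, hk₀⟩
      | succ n =>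
        obtain ⟨a, b, c⟩ := ih n (Nat.lt_succ_self n)
        have hn := hq (Q n) a b c
        refine ⟨hn.2.2.2.1, ?_, hn.2.2.2.2.1⟩
        have h1 := htraj (n + 1) ih _ le_rfl
        have h2 : 0 ≤ t (n + 1) := ht0 ▸ ht.monotone (Nat.zero_le _)
        have h3 := hstay _ x s h1 (by rw [hx0]; exact hx2) _ (right_mem_Icc.2 h2)
        rwa [hx n _ ⟨(ht (Nat.lt_succ_self n)).le, le_rfl⟩, hφs] at h3
  -- Of two consecutive steps at least one lasts `h`: a step cut short ends in a fresh state. Hence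
  -- the switching instants tend to infinity.
  have htwo : ∀ n, t n + h ≤ t (n + 2) := by
    intro n
    obtain ⟨a, b, c⟩ := hgood n
    obtain ⟨a', b', c'⟩ := hgood (n + 1)
    have h1 : t (n + 2) = t n + τ (Q n) + τ (Q (n + 1)) := by
      rw [← hts n, ← hts (n + 1)]
    have p1 := hτ (Q n)
    have p2 := hτ (Q (n + 1))
    rcases (hq (Q n) a b c).2.2.2.2.2.1 with e | e
    · linarith
    · have := (hq (Q (n + 1)) a' b' c').2.2.2.2.2.2 e
      linarith
  have htn : ∀ n : ℕ, n * h ≤ t (2 * n) := by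
    intro n
    induction n with
    | zero => simp [ht0]
    | succ n ih =>
      have := htwo (2 * n)
      rw [show 2 * (n + 1) = 2 * n + 2 by ring]
      push_cast
      linarith
  refine ⟨x, s, fun T _ => ?_, hx0⟩
  obtain ⟨n, hn⟩ := exists_nat_ge (T / h)
  rw [div_le_iff₀ hh] at hn
  exact htraj (2 * n) (fun m _ => hgood m) T (hn.trans (htn n))

/-! ### Stability and instability from the sign of the radial growth -/

theorem isAsymptoticallyStable_of_radialGrowth {p : Plane} (hp : G.IsNash p)
    (hG : G.HasComplexEigenvalues) (hg : ∀ i j, i ≠ j → G.grad i p j ≠ 0) {K : ℝ → Mode}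
    (hK : G.IsActiveMode p K) {θ₀ : ℝ} (hγ : G.A 1 0 1 * G.radialGrowth K θ₀ < 0) :
    G.IsAsymptoticallyStable p := by
  obtain ⟨W, m, hm, M, hM, c, hc, r, hr, hWc, hWb, hW⟩ :=
    G.exists_lyapunov hp hG hg hK (θ₀ := θ₀) (Or.inl rfl) (by rwa [one_mul])
  have hst := isStable_of_lyapunov hm hM hc hr hWc hWb hW
  obtain ⟨δ₁, hδ₁, hex⟩ := hst.exists_isTrajectory hp hG hg
  obtain ⟨δ₂, hδ₂, hstay⟩ := hst r hr
  refine ⟨hst, min δ₁ δ₂, lt_min hδ₁ hδ₂, fun x₀ hx₀ => hex x₀ (hx₀.trans_le (min_le_left _ _)),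
    fun x s hx hx0 => hx.tendsto_of_lyapunov hm hc hWc (fun y => (hWb y).1) hW fun u hu => ?_⟩
  exact hstay (u + 1) x s (hx _ (by linarith)) (hx0.trans_le (min_le_right _ _)) u
    ⟨hu, by linarith⟩

/-- Stability, assumed for contradiction, is itself what provides a global trajectory from a nearby
state other than `p`. It stays in the ball of radius `r`, where `W` is bounded by `M * r ^ 2` yet
grows exponentially. -/
theorem isUnstable_of_radialGrowth {p : Plane} (hp : G.IsNash p)
    (hG : G.HasComplexEigenvalues) (hg : ∀ i j, i ≠ j → G.grad i p j ≠ 0) {K : ℝ → Mode}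
    (hK : G.IsActiveMode p K) {θ₀ : ℝ} (hγ : 0 < G.A 1 0 1 * G.radialGrowth K θ₀) :
    G.IsUnstable p := by
  intro hst
  obtain ⟨W, m, hm, M, hM, c, hc, r, hr, hWc, hWb, hW⟩ :=
    G.exists_lyapunov hp hG hg hK (θ₀ := θ₀) (τ := -1) (Or.inr rfl) (by linarith)
  obtain ⟨δ₁, hδ₁, hex⟩ := hst.exists_isTrajectory hp hG hg
  obtain ⟨δ₂, hδ₂, hstay⟩ := hst r hr
  set d := min δ₁ δ₂ / 2 with hd
  have hd0 : 0 < d := by have := lt_min hδ₁ hδ₂; positivity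
  have hnorm : ‖(fun _ => d : Plane)‖ = d := by
    rw [pi_norm_const, Real.norm_of_nonneg hd0.le]
  have hdist : dist (p + fun _ => d) p = d := by rw [dist_eq_norm, add_sub_cancel_left, hnorm]
  have hdlt : d < min δ₁ δ₂ := by linarith
  obtain ⟨x, s, hx, hx0⟩ := hex (p + fun _ => d)
    (by rw [hdist]; exact hdlt.trans_le (min_le_left _ _))
  have hin : ∀ u ≥ 0, dist (x u) p < r := fun u hu =>
    hstay (u + 1) x s (hx _ (by linarith))
      (by rw [hx0, hdist]; exact hdlt.trans_le (min_le_right _ _)) u ⟨hu, by linarith⟩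
  have hW0 : 0 < W (x 0 - p) := by
    refine lt_of_lt_of_le ?_ (hWb (x 0 - p)).1
    rw [hx0, add_sub_cancel_left, hnorm]
    positivity
  have hlim : Tendsto (fun t : ℝ => W (x 0 - p) * Real.exp (c * t)) atTop atTop :=
    (Real.tendsto_exp_atTop.comp (tendsto_id.const_mul_atTop hc)).const_mul_atTop hW0
  obtain ⟨t, ht, hbig⟩ := ((eventually_gt_atTop 0).and
    (hlim.eventually_gt_atTop (M * r ^ 2))).exists
  have hle := (hx t ht).lyapunov_le (by norm_num) hWc hW (right_mem_Icc.2 ht.le)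
    fun u hu => hin u hu.1.le
  have h1 : W (x t - p) ≤ M * r ^ 2 := by
    refine (hWb _).2.trans ?_
    have := (hin t ht.le).le
    rw [dist_eq_norm] at this
    gcongr
  have h2 : W (x 0 - p) ≤ W (x t - p) * Real.exp (-1 * c * t) := by linarith
  have h3 : Real.exp (-1 * c * t) * Real.exp (c * t) = 1 := by
    rw [← Real.exp_add, show -1 * c * t + c * t = 0 by ring, Real.exp_zero]
  have h4 := mul_le_mul_of_nonneg_right h2 (Real.exp_pos (c * t)).le
  rw [mul_assoc, h3, mul_one] at h4
  linarith

end System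

end LossAversion

end

theorem theorem1 (G : LossAversion.System) (p : LossAversion.Plane) (hp : G.IsNash p)
    (hG : G.HasComplexEigenvalues)
    (hcase : ∀ i : Fin 2, (G.A i).mulVec p + G.b i ≠ 0)
    (K : ℝ → LossAversion.Mode) (hK : G.IsActiveMode p K) (θ₀ : ℝ) :
    (0 < G.A 0 0 1 * G.radialGrowth K θ₀ → G.A 1 0 1 * G.radialGrowth K θ₀ < 0 →
      G.IsAsymptoticallyStable p) ∧
    (G.A 0 0 1 * G.radialGrowth K θ₀ < 0 → 0 < G.A 1 0 1 * G.radialGrowth K θ₀ →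
      G.IsUnstable p) := by
  -- The own component of the gradient vanishes at a Nash equilibrium, so a nonzero gradient has a
  -- nonzero cross component.
  have hg : ∀ i j, i ≠ j → G.grad i p j ≠ 0 := by
    intro i j hij h0
    refine hcase i (funext fun l => ?_)
    by_cases hl : l = i
    · rw [hl]; exact hp.grad_eq_zero i
    · rw [LossAversion.eq_of_ne_of_ne hij hl]; exact h0
  exact ⟨fun _ hγ => G.isAsymptoticallyStable_of_radialGrowth hp hG hg hK hγ,
    fun _ hγ => G.isUnstable_of_radialGrowth hp hG hg hK hγ⟩
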